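/- Let $(M,g)$ be a compact connected $C^\infty$ Riemannian manifold without boundary, of dimension $n$. Let $L^2(M,TM)$ be the completion of the space of smooth vector fields for $\langle v,w\rangle=\int_M\langle v(x),w(x)\rangle_{g,x}\,d\mathrm{vol}(x)$, and give $L^2(M,TM)^m$ the product Hilbert norm. Let $\Delta_{TM}$ be the nonnegative self-adjoint Laplacian on vector fields, $\Delta_{TM}=\tilde d_0\tilde d_0^*+\tilde d_1^*\tilde d_1$ with $\tilde d_0=\alpha^{-1}\circ d$ on functions, $\tilde d_1=\alpha^{-1}\circ d\circ\alpha$ on vector fields, and $\alpha(v)=\langle v,\cdot\rangle_g$. Let $\{\lambda_j\}$ be the set of eigenvalues of $\Delta_{TM}^{1/2}$ and $E_{\lambda_j}\subset L^2(M,TM)$ the eigenspaces. Let $G$ be an abelian group with generators $\gamma_1,\dots,\gamma_k$ and with the relations given by the $\frac{k(k-1)}2$ words $\mathcal W_{i,l}=\gamma_i\gamma_l\gamma_i^{-1}\gamma_l^{-1}$, $1\le i<l\le k$. Let $\pi$ be an action of $G$ on $M$ by smooth isometries ($C^\infty$ diffeomorphisms preserving the Riemannian distance), and let $\pi(\gamma)_*$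 be the push-forward of vector fields, extended to $L^2(M,TM)$. Set $$d_0v=(v-\pi(\gamma_l)_*v)_{1\le l\le k},\quad v\in L^2(M,TM).$$ For $V=(v_l)_{1\le l\le k}\in L^2(M,TM)^k$ put $v_{\gamma_l}=v_l$, $v_{\gamma_l^{-1}}=-\pi(\gamma_l^{-1})_*v_l$, and let $d_1V$ be the tuple which has, for each relation $\mathcal W=s_1\cdots s_m$ with letters $s_z\in\{\gamma_l^{\pm1}\}$, the component $$(d_1V)_{\mathcal W}=\sum_{z=1}^{m}\pi(s_1\cdots s_{z-1})_*v_{s_z}.$$ Let $d_0^*,d_1^*$ be the $L^2$-adjoints and $\square=d_0d_0^*+d_1^*d_1$ on $L^2(M,TM)^k$. The action is called $d_0$-Diophantine if there are $\sigma>0$, $\tau\ge0$ with $\|d_0d_0^*u\|\ge\sigma(1+\lambda_j)^{-\tau}\|u\|$ for all $j$ and all $u\in\mathrm{Im}\,d_0\cap E_{\lambda_j}^k$. It is called $\square$-Diophantine if there are $\sigma>0$, $\tau\ge0$ with $\|\square V\|\ge\sigma(1+\lambda_j)^{-\tau}\|V\|$ for all $j$ and all $V\in\mathrm{Im}\,\square\cap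 E_{\lambda_j}^k$. Then $$\square u=\bigl((d_0^*d_0)u_i\bigr)_{1\le i\le k}\qquad\text{for all }u=(u_i)_{1\le i\le k}\in L^2(M,TM)^k,$$ in particular for all tuples of smooth vector fields. Moreover, if $\pi$ is $d_0$-Diophantine, then $\pi$ is $\square$-Diophantine. -/

import Mathlib

open Bundle Manifold MeasureTheory
open scoped ContDiff

set_option linter.unusedSectionVars false

noncomputable section

/-- The model space `ℝⁿ`. -/
abbrev Rn (n : ℕ) := EuclideanSpace ℝ (Fin n)

section Geometry

variable (n : ℕ) (M : Type*) [MetricSpace M] [ChartedSpace (Rn n) M] [IsManifold (𝓡 n) ∞ M]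
  [RiemannianBundle (fun x : M => TangentSpace (𝓡 n) x)]
  [IsContMDiffRiemannianBundle (𝓡 n) ∞ (Rn n) (fun x : M => TangentSpace (𝓡 n) x)]
  [CompactSpace M] [MeasurableSpace M] [BorelSpace M]

/-! ### The Riemannian volume -/

variable {M} in
/-- The coordinate vector field `∂/∂xᵢ` of the chart at `p`, at the point of coordinates `y`. -/
def coordVec (p : M) (i : Fin n) (y : Rn n) :
    TangentSpace (𝓡 n) ((extChartAt (𝓡 n) p).symm y) :=
  mfderiv 𝓘(ℝ, Rn n) (𝓡 n) (extChartAt (𝓡 n) p).symm y (EuclideanSpace.single i (1 : ℝ))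

variable {M} in
/-- The matrix `(g_{ij})` of the metric in the chart at `p`, at the point of coordinates `y`. -/
def gramMatrix (p : M) (y : Rn n) : Matrix (Fin n) (Fin n) ℝ :=
  Matrix.of fun i j => inner ℝ (coordVec n p i y) (coordVec n p j y)

variable {M} in
/-- The measure `√(det g_{ij}) dx₁ ⋯ dxₙ` on the domain of the chart at `p`, seen on `M`. -/
def chartVolume (p : M) : Measure M :=
  ((volume.restrict (extChartAt (𝓡 n) p).target).withDensity
    fun y => ENNReal.ofReal (Real.sqrt (gramMatrix n p y).det)).map (extChartAt (𝓡 n) p).symm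

/-- A smooth partition of unity subordinate to the charts of `M`. -/
def chartPartition : SmoothPartitionOfUnity M (𝓡 n) M :=
  (SmoothPartitionOfUnity.exists_isSubordinate_chartAt_source (𝓡 n) M).choose

/-- The Riemannian volume of `M`: the measure `√(det g_{ij}) dx₁ ⋯ dxₙ` in local coordinates,
glued with a partition of unity. -/
def riemannianVolume : Measure M :=
  Measure.sum fun p : M =>
    (chartVolume n p).withDensity fun x => ENNReal.ofReal (chartPartition n M p x)

variable {M} in
theorem continuousOn_gramMatrix_det (p : M) :
    ContinuousOn (fun y => (gramMatrix n p y).det) (extChartAt (𝓡 n) p).target := by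
  have hopen : IsOpen (extChartAt (𝓡 n) p).target := isOpen_extChartAt_target p
  have hs : ContMDiffOn 𝓘(ℝ, Rn n) (𝓡 n) ∞ (extChartAt (𝓡 n) p).symm
      (extChartAt (𝓡 n) p).target := contMDiffOn_extChartAt_symm p
  have hvec : ∀ i : Fin n, ContinuousOn (fun y => (⟨(extChartAt (𝓡 n) p).symm y,
      coordVec n p i y⟩ : TangentBundle (𝓡 n) M)) (extChartAt (𝓡 n) p).target := by
    intro i
    have h1 := hs.continuousOn_tangentMapWithin (by simp) hopen.uniqueMDiffOn
    have h2 : Continuous (fun y : Rn n =>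
        (⟨y, EuclideanSpace.single i (1 : ℝ)⟩ : TangentBundle 𝓘(ℝ, Rn n) (Rn n))) := by
      have := (tangentBundleModelSpaceHomeomorph 𝓘(ℝ, Rn n)).symm.continuous.comp
        (show Continuous (fun y : Rn n => ((y, EuclideanSpace.single i (1 : ℝ)) :
          ModelProd (Rn n) (Rn n))) from Continuous.prodMk continuous_id continuous_const)
      exact this
    have h3 := h1.comp h2.continuousOn (s := (extChartAt (𝓡 n) p).target) (fun y hy => hy)
    refine h3.congr fun y hy => ?_
    simp only [Function.comp, tangentMapWithin, coordVec]
    rw [mfderivWithin_of_isOpen hopen hy]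
  have hcont : IsContinuousRiemannianBundle (Rn n) (fun x : M => TangentSpace (𝓡 n) x) := by
    obtain ⟨g, hg, h⟩ := IsContMDiffRiemannianBundle.exists_contMDiff (IB := 𝓡 n) (n := ∞)
      (F := Rn n) (E := fun x : M => TangentSpace (𝓡 n) x)
    exact ⟨g, hg.continuous, h⟩
  have hent : ∀ i j, ContinuousOn (fun y => gramMatrix n p y i j)
      (extChartAt (𝓡 n) p).target := fun i j =>
    ContinuousOn.inner_bundle (hvec i) (hvec j)
  simp only [Matrix.det_apply]
  fun_prop (disch := assumption)

variable {M} in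
theorem chartVolume_lt_top (p : M) {K : Set M} (hK : IsCompact K)
    (hKp : K ⊆ (chartAt (Rn n) p).source) : chartVolume n p K < ⊤ := by
  have hopen : IsOpen (extChartAt (𝓡 n) p).target := isOpen_extChartAt_target p
  have hc := (continuousOn_gramMatrix_det n p).sqrt
  have himg : IsCompact (extChartAt (𝓡 n) p '' K) :=
    hK.image_of_continuousOn ((continuousOn_extChartAt p).mono (by simpa using hKp))
  have hsub : extChartAt (𝓡 n) p '' K ⊆ (extChartAt (𝓡 n) p).target := by
    rintro _ ⟨x, hx, rfl⟩
    exact (extChartAt (𝓡 n) p).map_source (by simpa using hKp hx)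
  obtain ⟨C, hC⟩ := himg.exists_bound_of_continuousOn (hc.mono hsub)
  rw [chartVolume, Measure.map_apply_of_aemeasurable _ hK.measurableSet]
  · rw [withDensity_apply' , Measure.restrict_restrict']
    · have hset : (extChartAt (𝓡 n) p).symm ⁻¹' K ∩ (extChartAt (𝓡 n) p).target
          = extChartAt (𝓡 n) p '' K := by
        ext y
        constructor
        · rintro ⟨h1, h2⟩
          exact ⟨_, h1, (extChartAt (𝓡 n) p).right_inv h2⟩
        · rintro ⟨x, hx, rfl⟩
          refine ⟨?_, hsub ⟨x, hx, rfl⟩⟩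
          rw [Set.mem_preimage, (extChartAt (𝓡 n) p).left_inv
            (show x ∈ (extChartAt (𝓡 n) p).source by simpa using hKp hx)]
          exact hx
      rw [hset]
      calc _ ≤ ∫⁻ _ in extChartAt (𝓡 n) p '' K, ENNReal.ofReal C := by
            refine setLIntegral_mono' himg.measurableSet fun y hy => ?_
            exact ENNReal.ofReal_le_ofReal ((le_abs_self _).trans (hC y hy))
        _ < ⊤ := by
            rw [setLIntegral_const]
            exact ENNReal.mul_lt_top ENNReal.ofReal_lt_top himg.measure_lt_top
    · exact hopen.measurableSet
  · refine AEMeasurable.mono_ac ?_ (withDensity_absolutelyContinuous _ _)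
    exact (continuousOn_extChartAt_symm p).aemeasurable hopen.measurableSet

instance isFiniteMeasure_riemannianVolume : IsFiniteMeasure (riemannianVolume n M) := by
  constructor
  have hsub := (SmoothPartitionOfUnity.exists_isSubordinate_chartAt_source (𝓡 n) M).choose_spec
  have hfin : {p : M | (Function.support (chartPartition n M p)).Nonempty}.Finite :=
    (chartPartition n M).locallyFinite.finite_nonempty_of_compact
  rw [riemannianVolume, Measure.sum_apply _ MeasurableSet.univ,
    tsum_eq_sum (s := hfin.toFinset)]
  · refine ENNReal.sum_lt_top.2 fun p _ => ?_
    have hK : IsCompact (tsupport (chartPartition n M p)) := (isClosed_tsupport _).isCompact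
    refine lt_of_le_of_lt ?_ (chartVolume_lt_top n p hK (hsub p))
    rw [withDensity_apply _ MeasurableSet.univ, Measure.restrict_univ,
      ← lintegral_indicator_one hK.measurableSet]
    refine lintegral_mono fun x => ?_
    by_cases hx : x ∈ tsupport (chartPartition n M p)
    · simpa [hx] using (chartPartition n M).le_one p x
    · simp [hx, image_eq_zero_of_notMem_tsupport hx]
  · intro p hp
    have : ∀ x, chartPartition n M p x = 0 := by
      intro x
      by_contra hx
      exact hp (hfin.mem_toFinset.2 ⟨x, hx⟩)
    simp [this]

/-! ### Smooth vector fields and `L²(M, TM)` -/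

/-- The space `Γ^∞(M, TM)` of smooth vector fields. -/
def SmoothVF : Type _ := Cₛ^∞⟮𝓡 n; Rn n, fun x : M => TangentSpace (𝓡 n) x⟯

instance : AddCommGroup (SmoothVF n M) :=
  inferInstanceAs (AddCommGroup Cₛ^∞⟮𝓡 n; Rn n, fun x : M => TangentSpace (𝓡 n) x⟯)

instance : Module ℝ (SmoothVF n M) :=
  inferInstanceAs (Module ℝ Cₛ^∞⟮𝓡 n; Rn n, fun x : M => TangentSpace (𝓡 n) x⟯)

instance : CoeFun (SmoothVF n M) fun _ => ∀ x : M, TangentSpace (𝓡 n) x :=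
  ⟨fun v => ContMDiffSection.toFun v⟩

theorem SmoothVF.integrable_inner (v w : SmoothVF n M) :
    Integrable (fun x => inner ℝ (v x) (w x)) (riemannianVolume n M) := by
  have h : ContMDiff (𝓡 n) 𝓘(ℝ, ℝ) ∞ (fun x => inner ℝ (v x) (w x)) :=
    ContMDiff.inner_bundle (ContMDiffSection.contMDiff_toFun v)
      (ContMDiffSection.contMDiff_toFun w)
  exact h.continuous.integrable_of_hasCompactSupport (HasCompactSupport.of_compactSpace _)

/-- The `L²` scalar product `⟨v, w⟩ = ∫_M ⟨v(x), w(x)⟩ dvol(x)` of smooth vector fields. -/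
instance SmoothVF.core : PreInnerProductSpace.Core ℝ (SmoothVF n M) where
  inner v w := ∫ x, inner ℝ (v x) (w x) ∂(riemannianVolume n M)
  conj_inner_symm v w := by
    simp only [conj_trivial]
    exact integral_congr_ae (.of_forall fun x => real_inner_comm _ _)
  re_inner_nonneg v := integral_nonneg fun x => real_inner_self_nonneg
  add_left u v w := by
    rw [← integral_add (SmoothVF.integrable_inner n M u w) (SmoothVF.integrable_inner n M v w)]
    exact integral_congr_ae (.of_forall fun x => inner_add_left _ _ _)
  smul_left u v r := by
    rw [← integral_const_mul]
    exact integral_congr_ae (.of_forall fun x => inner_smul_left _ _ _)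

instance : SeminormedAddCommGroup (SmoothVF n M) :=
  InnerProductSpace.Core.toSeminormedAddCommGroup (𝕜 := ℝ)

instance : InnerProductSpace ℝ (SmoothVF n M) := InnerProductSpace.ofCore (SmoothVF.core n M)

/-- `L²(M, TM)`: the completion of the space of smooth vector fields for the `L²` scalar
product. -/
abbrev L2VF : Type _ := UniformSpace.Completion (SmoothVF n M)

/-- The inclusion of the smooth vector fields in `L²(M, TM)`. -/
def toL2 : SmoothVF n M →ₗ[ℝ] L2VF n M :=
  (UniformSpace.Completion.toComplₗᵢ (𝕜 := ℝ) (E := SmoothVF n M)).toLinearMap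

/-! ### The Laplacian on the tangent bundle -/

variable {n M}

/-- The one-form `α(v) = ⟨v, ·⟩` dual to the vector field `v`, read in the chart at `p`. -/
def flatInChart (v : SmoothVF n M) (p : M) (y : Rn n) : Rn n [⋀^Fin 1]→L[ℝ] ℝ :=
  ContinuousAlternatingMap.ofSubsingleton ℝ (Rn n) ℝ (0 : Fin 1)
    ((innerSL ℝ (v ((extChartAt (𝓡 n) p).symm y))).comp
      (mfderiv 𝓘(ℝ, Rn n) (𝓡 n) (extChartAt (𝓡 n) p).symm y))

/-- The exterior derivative `d(α(v))` at `x`, applied to two tangent vectors (computed in the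
chart at `x`). -/
def dFlat (v : SmoothVF n M) (x : M) (a b : TangentSpace (𝓡 n) x) : ℝ :=
  extDeriv (flatInChart v x) (extChartAt (𝓡 n) x x)
    ![mfderiv (𝓡 n) 𝓘(ℝ, Rn n) (extChartAt (𝓡 n) x) x a,
      mfderiv (𝓡 n) 𝓘(ℝ, Rn n) (extChartAt (𝓡 n) x) x b]

instance (x : M) : FiniteDimensional ℝ (TangentSpace (𝓡 n) x) :=
  inferInstanceAs (FiniteDimensional ℝ (Rn n))

/-- The scalar product of `d(α(v))` and `d(α(w))` at `x`, for the scalar product on `∧²` in which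
the `eᵢ ∧ eⱼ`, `i < j`, are orthonormal when `(eᵢ)` is an orthonormal basis of `T_x M`. -/
def innerDFlat (v w : SmoothVF n M) (x : M) : ℝ :=
  let e := stdOrthonormalBasis ℝ (TangentSpace (𝓡 n) x)
  ∑ i, ∑ j ∈ Finset.Ioi i, dFlat v x (e i) (e j) * dFlat w x (e i) (e j)

/-- `h = d̃₀* v`, where `d̃₀` is the gradient: `⟨h, f⟩ = ⟨v, d̃₀ f⟩` for all smooth functions `f`
(note that `⟨v, grad f⟩ = df(v)`). -/
def IsGradAdjoint (v : SmoothVF n M) (h : C^∞⟮𝓡 n, M; 𝓘(ℝ, ℝ), ℝ⟯) : Prop :=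
  ∀ f : C^∞⟮𝓡 n, M; 𝓘(ℝ, ℝ), ℝ⟯,
    ∫ x, h x * f x ∂(riemannianVolume n M) =
      ∫ x, (mfderiv (𝓡 n) 𝓘(ℝ, ℝ) f x (v x) : ℝ) ∂(riemannianVolume n M)

/-- `w = Δ_{TM} v`, where `Δ_{TM} = d̃₀ d̃₀* + d̃₁* d̃₁`, with `d̃₀ = α⁻¹ ∘ d` the gradient on
functions and `d̃₁ = α⁻¹ ∘ d ∘ α` on vector fields; the adjoints are the `L²` (formal) adjoints:
with `h = d̃₀* v`, one has `⟨w, φ⟩ = ⟨d̃₀ h, φ⟩ + ⟨d̃₁ v, d̃₁ φ⟩` for all smooth fields `φ`. -/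
def IsTangentLaplacian (v w : SmoothVF n M) : Prop :=
  ∃ h : C^∞⟮𝓡 n, M; 𝓘(ℝ, ℝ), ℝ⟯, IsGradAdjoint v h ∧
    ∀ φ : SmoothVF n M,
      ∫ x, inner ℝ (w x) (φ x) ∂(riemannianVolume n M) =
        ∫ x, (mfderiv (𝓡 n) 𝓘(ℝ, ℝ) h x (φ x) : ℝ) ∂(riemannianVolume n M) +
        ∫ x, innerDFlat v φ x ∂(riemannianVolume n M)

variable (n M)

/-- The eigenspace `E_l ⊆ L²(M, TM)` of `|Δ_{TM}|^{1/2}` for the value `l`, i.e. the eigenspace of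
the (nonnegative, self-adjoint) operator `Δ_{TM}` on `L²(M, TM)` for the value `l²`: the `u` with
`⟨u, Δ_{TM} φ⟩ = l² ⟨u, φ⟩` for all smooth vector fields `φ`. (`Δ_{TM}` is essentially
self-adjoint on smooth vector fields, so it is the adjoint of its restriction to them.) -/
def tangentEigenspace (l : ℝ) : Submodule ℝ (L2VF n M) where
  carrier := {u | ∀ φ ψ : SmoothVF n M, IsTangentLaplacian φ ψ →
    inner ℝ u (toL2 n M ψ) = l ^ 2 * inner ℝ u (toL2 n M φ)}
  add_mem' := by
    intro u v hu hv φ ψ h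
    rw [inner_add_left, inner_add_left, hu φ ψ h, hv φ ψ h, mul_add]
  zero_mem' := by
    intro φ ψ _
    simp
  smul_mem' := by
    intro c u hu φ ψ h
    rw [real_inner_smul_left, real_inner_smul_left, hu φ ψ h]
    ring

/-- The set `{λ_j}` of eigenvalues of `|Δ_{TM}|^{1/2}`. -/
def tangentSpectrum : Set ℝ := {l | 0 ≤ l ∧ tangentEigenspace n M l ≠ ⊥}

/-! ### Push-forward of vector fields -/

variable {n M}

/-- The push-forward `f_* v (x) = Df(f⁻¹(x)) v(f⁻¹(x))` of a smooth vector field `v`. -/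
def pushField (f : M ≃ₘ^∞⟮𝓡 n, 𝓡 n⟯ M) (v : SmoothVF n M) (x : M) : TangentSpace (𝓡 n) x :=
  (mfderiv (𝓡 n) (𝓡 n) f (f.symm x) (v (f.symm x)) : Rn n)

theorem contMDiff_pushField (f : M ≃ₘ^∞⟮𝓡 n, 𝓡 n⟯ M) (v : SmoothVF n M) :
    ContMDiff (𝓡 n) ((𝓡 n).prod 𝓘(ℝ, Rn n)) ∞
      fun x => (⟨x, pushField f v x⟩ : TangentBundle (𝓡 n) M) := by
  have h1 := (f.contMDiff.contMDiff_tangentMap (m := ∞) (by simp)).comp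
    ((ContMDiffSection.contMDiff_toFun v).comp f.symm.contMDiff)
  refine h1.congr fun x => ?_
  have key : ∀ (y : M) (_ : x = y) (a : Rn n),
      (⟨x, a⟩ : TangentBundle (𝓡 n) M) = ⟨y, a⟩ := by
    rintro _ rfl a
    rfl
  exact key _ (f.apply_symm_apply x).symm _

/-- The push-forward of smooth vector fields by a diffeomorphism, as a linear map. -/
def pushSmooth (f : M ≃ₘ^∞⟮𝓡 n, 𝓡 n⟯ M) : SmoothVF n M →ₗ[ℝ] SmoothVF n M where
  toFun v := ContMDiffSection.mk (pushField f v) (contMDiff_pushField f v)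
  map_add' v w := ContMDiffSection.ext fun x =>
    map_add (mfderiv (𝓡 n) (𝓡 n) f (f.symm x)) (v (f.symm x)) (w (f.symm x))
  map_smul' c v := ContMDiffSection.ext fun x =>
    map_smul (mfderiv (𝓡 n) (𝓡 n) f (f.symm x)) c (v (f.symm x))

/-- The push-forward on `L²(M, TM)`: the continuous extension of the push-forward of smooth
vector fields (which preserves the `L²` norm when `f` is an isometry). -/
def pushL2 (f : M ≃ₘ^∞⟮𝓡 n, 𝓡 n⟯ M) : L2VF n M →L[ℝ] L2VF n M :=
  ((toL2 n M).comp (pushSmooth f)).extendOfNorm (toL2 n M)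

/-! ### Isometric actions, the operators `d₀`, `d₁` and the Box operator -/

variable (n M) in
/-- An action of `G` on `M` by smooth isometries, i.e. `C^∞` diffeomorphisms which preserve the
distance induced by the Riemannian metric. -/
structure IsometricAction (G : Type*) [Group G] where
  /-- The diffeomorphism `ρ(a)`. -/
  toDiffeo : G → M ≃ₘ^∞⟮𝓡 n, 𝓡 n⟯ M
  map_mul : ∀ a b x, toDiffeo (a * b) x = toDiffeo a (toDiffeo b x)
  isometry : ∀ a, Isometry (toDiffeo a)

variable (n M) in
/-- `L²(M, TM)^ι` with its Hilbert space structure. -/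
abbrev L2Tuple (ι : Type*) [Fintype ι] : Type _ := PiLp 2 fun _ : ι => L2VF n M

/-- The operator with values in `L²(M, TM)^ι` with the given components. -/
def tupleMap {ι : Type*} [Fintype ι] {V : Type*} [NormedAddCommGroup V] [InnerProductSpace ℝ V]
    (T : ι → V →L[ℝ] L2VF n M) : V →L[ℝ] L2Tuple n M ι :=
  (PiLp.continuousLinearEquiv 2 ℝ fun _ : ι => L2VF n M).symm.toContinuousLinearMap.comp
    (ContinuousLinearMap.pi T)

namespace IsometricAction

variable {G : Type*} [Group G] (ρ : IsometricAction n M G) {k : ℕ} (γ : Fin k → G)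

/-- The operator `ρ(a)_*` on `L²(M, TM)`. -/
def push (a : G) : L2VF n M →L[ℝ] L2VF n M := pushL2 (ρ.toDiffeo a)

/-- `d₀ v = (v - ρ(γ_l)_* v)_l`. -/
def d₀ : L2VF n M →L[ℝ] L2Tuple n M (Fin k) :=
  tupleMap fun l => ContinuousLinearMap.id ℝ (L2VF n M) - ρ.push (γ l)

/-- The element `γ_l` or `γ_l⁻¹` of `G` given by a letter `(l, true)` or `(l, false)`. -/
def letter (s : Fin k × Bool) : G := if s.2 then γ s.1 else (γ s.1)⁻¹

/-- The component of `V = (v_l)_l` at a letter: `v_l` at `γ_l`, and `-ρ(γ_l⁻¹)_* v_l` at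
`γ_l⁻¹`. -/
def component (s : Fin k × Bool) : L2Tuple n M (Fin k) →L[ℝ] L2VF n M :=
  if s.2 then PiLp.proj 2 (fun _ : Fin k => L2VF n M) s.1
  else -(ρ.push (γ s.1)⁻¹).comp (PiLp.proj 2 (fun _ : Fin k => L2VF n M) s.1)

/-- For the relations given by the words `W r = s₁ ⋯ s_m` in the letters `γ_l^{±1}`,
`(d₁ V)_r = ∑_z ρ(s₁ ⋯ s_{z-1})_* v_{s_z}`. -/
def d₁ {R : Type*} [Fintype R] (W : R → List (Fin k × Bool)) :
    L2Tuple n M (Fin k) →L[ℝ] L2Tuple n M R :=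
  tupleMap fun r => ∑ z : Fin (W r).length,
    (ρ.push (((W r).take z).map (letter γ)).prod).comp (ρ.component γ ((W r).get z))

/-- The adjoint `d₀*` for the `L²` scalar product. -/
def d₀Adj : L2Tuple n M (Fin k) →L[ℝ] L2VF n M := ContinuousLinearMap.adjoint (ρ.d₀ γ)

/-- The adjoint `d₁*` for the `L²` scalar product. -/
def d₁Adj {R : Type*} [Fintype R] (W : R → List (Fin k × Bool)) :
    L2Tuple n M R →L[ℝ] L2Tuple n M (Fin k) := ContinuousLinearMap.adjoint (ρ.d₁ γ W)

/-- The Box operator `□ = d₀ d₀* + d₁* d₁`. -/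
def box {R : Type*} [Fintype R] (W : R → List (Fin k × Bool)) :
    L2Tuple n M (Fin k) →L[ℝ] L2Tuple n M (Fin k) :=
  (ρ.d₀ γ).comp (ρ.d₀Adj γ) + (ρ.d₁Adj γ W).comp (ρ.d₁ γ W)

/-- The action is `d₀`-Diophantine. -/
def IsD₀Diophantine : Prop :=
  ∃ σ τ : ℝ, 0 < σ ∧ 0 ≤ τ ∧ ∀ l ∈ tangentSpectrum n M, ∀ u : L2Tuple n M (Fin k),
    u ∈ Set.range (ρ.d₀ γ) → (∀ i, u i ∈ tangentEigenspace n M l) →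
      σ / (1 + l) ^ τ * ‖u‖ ≤ ‖ρ.d₀ γ (ρ.d₀Adj γ u)‖

/-- The action is `□`-Diophantine. -/
def IsBoxDiophantine {R : Type*} [Fintype R] (W : R → List (Fin k × Bool)) : Prop :=
  ∃ σ τ : ℝ, 0 < σ ∧ 0 ≤ τ ∧ ∀ l ∈ tangentSpectrum n M, ∀ u : L2Tuple n M (Fin k),
    u ∈ Set.range (ρ.box γ W) → (∀ i, u i ∈ tangentEigenspace n M l) →
      σ / (1 + l) ^ τ * ‖u‖ ≤ ‖ρ.box γ W u‖

end IsometricAction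

/-- The relations `γ_i γ_l γ_i⁻¹ γ_l⁻¹`, `i < l`, as words in the letters `γ_l^{±1}`. -/
def commutatorWords (k : ℕ) (q : {q : Fin k × Fin k // q.1 < q.2}) : List (Fin k × Bool) :=
  [(q.1.1, true), (q.1.2, true), (q.1.1, false), (q.1.2, false)]

end Geometry

end

/-!
Write `U_l` for `ρ(γ_l)_*` on `L²(M, TM)` and `A_l = 1 - U_l`, so that `d₀ v = (A_l v)_l`.

*The formula for `□`.* The word `γ_a γ_b γ_a⁻¹ γ_b⁻¹` gives the component `A_b v_a - A_a v_b` of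
`d₁` (`d₁_commutatorWords`). The `U_l` are commuting unitary operators, so that each `A_a` commutes
with each `A_b*`; expanding `⟨d₀* u, d₀* v⟩ + ⟨d₁ u, d₁ v⟩`, the mixed terms cancel and
`∑ ⟨A_b* A_b u_a, v_a⟩` remains (`box_apply`).

*The `U_l` are unitary.* A smooth map which preserves the Riemannian distance has an isometric
derivative (`inner_mfderiv_of_isometry`): to first order, the distance from `x` to a point `y` is
the norm of the displacement in the chart at `x`. Hence its Jacobian between two charts turns
`√det g` into `√det g`, and it preserves the volume (`measurePreserving_of_isometry`), hence the
`L²` scalar product of vector fields; this passes to the completion (`inner_pushL2`).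

*The Diophantine condition.* The Laplacian is defined by the metric and by `d`, which commutes with
pull-backs, so the `U_l` commute with it (`IsTangentLaplacian.push`) and preserve its eigenspaces.
If `E` is an eigenspace and `P = d₀* d₀`, the hypothesis applied to `d₀ y`, `y ∈ E`, reads
`‖d₀ P y‖ ≥ c ‖d₀ y‖`. For `w ∈ E` in the range of `P`, write `w = P y` with `y ∈ E`; two
Cauchy-Schwarz inequalities, `‖w‖² ≤ ‖d₀ y‖ ‖d₀ w‖` and `‖d₀ w‖² ≤ ‖P w‖ ‖w‖`, give `‖P w‖ ≥ c ‖w‖`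
(`norm_adjoint_comp_ge`) without recourse to the spectral theorem. By the formula for `□`, this
bound holds for each component of an element of `Im □` with components in `E`.
-/

noncomputable section

open Filter Topology Set
open scoped ENNReal NNReal

/-! ### The derivative of a distance-preserving map -/

section Infinitesimal

variable {n : ℕ} {M : Type*} [MetricSpace M] [ChartedSpace (Rn n) M] [IsManifold (𝓡 n) ∞ M]
  [RiemannianBundle (fun x : M => TangentSpace (𝓡 n) x)]
  [IsContMDiffRiemannianBundle (𝓡 n) ∞ (Rn n) (fun x : M => TangentSpace (𝓡 n) x)]

instance isContinuousRiemannianBundle_tangent :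
    IsContinuousRiemannianBundle (Rn n) (fun x : M => TangentSpace (𝓡 n) x) := by
  obtain ⟨g, hg, h⟩ := IsContMDiffRiemannianBundle.exists_contMDiff (IB := 𝓡 n) (n := ∞)
    (F := Rn n) (E := fun x : M => TangentSpace (𝓡 n) x)
  exact ⟨g, hg.continuous, h⟩

/-- The function `y ↦ ⟨e, y⟩` in the chart at `x`. The derivative of this chart at `x` is the
identity for the identification of `T_x M` with `ℝⁿ`, so the value of the chart is read as a tangent
vector at `x`; the differential at `x` is then `⟨e, ·⟩`. -/
def linearTest (x : M) (e : TangentSpace (𝓡 n) x) (y : M) : ℝ :=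
  (inner ℝ e (extChartAt (𝓡 n) x y : TangentSpace (𝓡 n) x) : ℝ)

/-- The linear form `⟨e, ·⟩` for the metric at `x`, on the model space. -/
def innerForm (x : M) (e : TangentSpace (𝓡 n) x) : Rn n →L[ℝ] ℝ :=
  (innerSL ℝ e : TangentSpace (𝓡 n) x →L[ℝ] ℝ)

/-- The differential of a function `φ : M → ℝ`, with values in `ℝ` rather than in a tangent space
of `ℝ`. -/
def differential (φ : M → ℝ) (y : M) : TangentSpace (𝓡 n) y →L[ℝ] ℝ :=
  mfderiv (𝓡 n) 𝓘(ℝ, ℝ) φ y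

theorem hasMFDerivAt_linearTest (x : M) (e : TangentSpace (𝓡 n) x) {y : M}
    (hy : y ∈ (chartAt (Rn n) x).source) :
    HasMFDerivAt (𝓡 n) 𝓘(ℝ, ℝ) (linearTest x e) y
      ((innerForm x e).comp (mfderiv (𝓡 n) 𝓘(ℝ, Rn n) (extChartAt (𝓡 n) x) y)) := by
  have h1 := (mdifferentiableAt_extChartAt (I := 𝓡 n) hy).hasMFDerivAt
  have h2 : HasMFDerivAt 𝓘(ℝ, Rn n) 𝓘(ℝ, ℝ) (innerForm x e) (extChartAt (𝓡 n) x y) (innerForm x e) :=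
    (innerForm x e).hasMFDerivAt
  exact h2.comp y h1

/-- The differential of `linearTest x e` has norm at most `r ‖e‖` near `x`, for each `r > 1`: the
metric is continuous. -/
theorem eventually_abs_mfderiv_linearTest_le (x : M) (e : TangentSpace (𝓡 n) x) {r : ℝ}
    (hr : 1 < r) :
    ∀ᶠ y in 𝓝 x, ∀ v : TangentSpace (𝓡 n) y,
      |differential (linearTest x e) y v| ≤ ‖e‖ * r * ‖v‖ := by
  filter_upwards [eventually_norm_symmL_trivializationAt_self_comp_lt (Rn n)
    (fun x : M => TangentSpace (𝓡 n) x) x hr, chart_source_mem_nhds (Rn n) x] with y hy hys v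
  rw [differential, (hasMFDerivAt_linearTest x e hys).mfderiv]
  have key : innerForm x e (mfderiv (𝓡 n) 𝓘(ℝ, Rn n) (extChartAt (𝓡 n) x) y v) =
      inner ℝ e (((trivializationAt (Rn n) (fun x : M => TangentSpace (𝓡 n) x) x).symmL ℝ x)
      ((trivializationAt (Rn n) (fun x : M => TangentSpace (𝓡 n) x) x).continuousLinearMapAt ℝ y v)) := by
    rw [TangentBundle.symmL_trivializationAt (mem_chart_source _ x),
      mfderivWithin_range_extChartAt_symm]
    have := TangentBundle.continuousLinearMapAt_trivializationAt (I := 𝓡 n) (𝕜 := ℝ) hys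
    erw [this]
    rfl
  show |innerForm x e (mfderiv (𝓡 n) 𝓘(ℝ, Rn n) (extChartAt (𝓡 n) x) y v)| ≤ _
  rw [key, mul_assoc]
  refine (abs_real_inner_le_norm _ _).trans ?_
  refine mul_le_mul_of_nonneg_left ?_ (norm_nonneg _)
  refine le_trans ?_ (mul_le_mul_of_nonneg_right hy.le (norm_nonneg _))
  exact ContinuousLinearMap.le_opNorm (((trivializationAt (Rn n) (fun x : M => TangentSpace (𝓡 n) x) x).symmL ℝ x) ∘L
      ((trivializationAt (Rn n) (fun x : M => TangentSpace (𝓡 n) x) x).continuousLinearMapAt ℝ y)) v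

/-- The sharp lower bound of the Riemannian distance near `x`: a short path from `x` stays where the
differential of `linearTest x e` is bounded by `r ‖e‖`. -/
theorem eventually_abs_linearTest_sub_le [IsRiemannianManifold (𝓡 n) M]
    (x : M) (e : TangentSpace (𝓡 n) x) {r : ℝ} (hr : 1 < r) :
    ∀ᶠ y in 𝓝 x, |linearTest x e y - linearTest x e x| ≤ ‖e‖ * r * dist x y := by
  obtain ⟨c, hc, hcs⟩ := setOfPred_riemannianEDist_lt_subset_nhds' (𝓡 n) (M := M)
    (Filter.inter_mem (eventually_abs_mfderiv_linearTest_le x e hr)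
      (chart_source_mem_nhds (Rn n) x))
  have hball : Metric.eball x c ∈ 𝓝 x := Metric.eball_mem_nhds x hc
  filter_upwards [hball] with y hy
  have hC : 0 ≤ ‖e‖ * r := by positivity
  -- it suffices to bound the variation of the test function by the length of any short path
  suffices h : ∀ L : ℝ≥0∞, edist x y < L → L < c →
      ENNReal.ofReal |linearTest x e y - linearTest x e x| ≤ ENNReal.ofReal (‖e‖ * r) * L by
    have h2 : ENNReal.ofReal |linearTest x e y - linearTest x e x| ≤
        ENNReal.ofReal (‖e‖ * r) * edist x y := by
      have hy' : edist x y < c := by rw [edist_comm]; exact hy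
      have hT : Tendsto (fun L => ENNReal.ofReal (‖e‖ * r) * L) (𝓝[>] (edist x y))
          (𝓝 (ENNReal.ofReal (‖e‖ * r) * edist x y)) :=
        (ENNReal.Tendsto.const_mul tendsto_id (Or.inr ENNReal.ofReal_ne_top)).mono_left
          nhdsWithin_le_nhds
      have : (𝓝[>] (edist x y)).NeBot := nhdsGT_neBot_of_exists_gt ⟨c, hy'⟩
      refine ge_of_tendsto hT ?_
      filter_upwards [self_mem_nhdsWithin, nhdsWithin_le_nhds (Iio_mem_nhds hy')] with L h1 h2
      exact h L h1 h2
    rw [edist_dist, ← ENNReal.ofReal_mul hC] at h2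
    exact (ENNReal.ofReal_le_ofReal_iff (by positivity)).1 h2
  intro L hL hLc
  rw [IsRiemannianManifold.out (I := 𝓡 n) x y] at hL
  obtain ⟨γ, hγ0, hγ1, hγs, hγL, -⟩ :=
    exists_lt_locally_constant_of_riemannianEDist_lt hL zero_lt_one
  have hin : ∀ t ∈ Icc (0 : ℝ) 1, γ t ∈ {y | ∀ v : TangentSpace (𝓡 n) y,
      |differential (linearTest x e) y v| ≤ ‖e‖ * r * ‖v‖} ∩
      (chartAt (Rn n) x).source := by
    intro t ht
    apply hcs
    show riemannianEDist (𝓡 n) x (γ t) < c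
    calc _ ≤ pathELength (𝓡 n) γ 0 t :=
          riemannianEDist_le_pathELength hγs.contMDiffOn hγ0 rfl ht.1
      _ ≤ pathELength (𝓡 n) γ 0 1 := pathELength_mono le_rfl ht.2
      _ < c := hγL.trans hLc
  have hφ : ∀ t ∈ Icc (0 : ℝ) 1, ContMDiffAt (𝓡 n) 𝓘(ℝ, ℝ) 1 (linearTest x e) (γ t) := by
    intro t ht
    have h1 : ContMDiffAt (𝓡 n) 𝓘(ℝ, Rn n) 1 (extChartAt (𝓡 n) x) (γ t) :=
      contMDiffAt_extChartAt' (hin t ht).2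
    have h2 : ContMDiff 𝓘(ℝ, Rn n) 𝓘(ℝ, ℝ) 1 (innerForm x e) := (innerForm x e).contMDiff
    exact (h2 _).comp _ h1
  have hcomp : ContDiffOn ℝ 1 (linearTest x e ∘ γ) (Icc 0 1) := by
    rw [← contMDiffOn_iff_contDiffOn]
    exact fun t ht => ((hφ t ht).comp t hγs.contMDiffAt).contMDiffWithinAt
  have h3 := enorm_sub_le_lintegral_derivWithin_Icc_of_contDiffOn_Icc hcomp zero_le_one
  rw [Function.comp_apply, Function.comp_apply, hγ0, hγ1, ← ofReal_norm, Real.norm_eq_abs] at h3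
  refine h3.trans ?_
  have h4 : ENNReal.ofReal (‖e‖ * r) * pathELength (𝓡 n) γ 0 1 ≤ ENNReal.ofReal (‖e‖ * r) * L := by
    gcongr
  refine le_trans ?_ h4
  rw [pathELength_eq_lintegral_mfderiv_Icc, ← lintegral_const_mul' _ _ ENNReal.ofReal_ne_top]
  refine setLIntegral_mono' measurableSet_Icc fun t ht => ?_
  have h5 : HasMFDerivAt 𝓘(ℝ, ℝ) 𝓘(ℝ, ℝ) (linearTest x e ∘ γ) t
      ((mfderiv (𝓡 n) 𝓘(ℝ, ℝ) (linearTest x e) (γ t)).comp (mfderiv 𝓘(ℝ, ℝ) (𝓡 n) γ t)) :=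
    (((hφ t ht).mdifferentiableAt one_ne_zero).hasMFDerivAt).comp t
      ((hγs.mdifferentiable one_ne_zero t).hasMFDerivAt)
  have h6 : derivWithin (linearTest x e ∘ γ) (Icc 0 1) t =
      differential (linearTest x e) (γ t) (mfderiv 𝓘(ℝ, ℝ) (𝓡 n) γ t (1 : ℝ)) := by
    have h8 : HasFDerivAt (linearTest x e ∘ γ) ((differential (linearTest x e) (γ t)).comp
        (mfderiv 𝓘(ℝ, ℝ) (𝓡 n) γ t) : ℝ →L[ℝ] ℝ) t := hasMFDerivAt_iff_hasFDerivAt.1 h5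
    exact h8.hasDerivAt.hasDerivWithinAt.derivWithin (uniqueDiffOn_Icc zero_lt_one t ht)
  have h7 := (hin t ht).1 (mfderiv 𝓘(ℝ, ℝ) (𝓡 n) γ t (1 : ℝ))
  show ‖derivWithin (linearTest x e ∘ γ) (Icc 0 1) t‖ₑ ≤ _
  rw [h6, ← ofReal_norm, ← ofReal_norm, ← ENNReal.ofReal_mul hC]
  exact ENNReal.ofReal_le_ofReal h7

/-- The vector field of constant coordinates `w` in the chart at `p`, at the point of coordinates
`y`. -/
def chartField (p : M) (w : Rn n) (y : Rn n) : TangentSpace (𝓡 n) ((extChartAt (𝓡 n) p).symm y) :=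
  mfderiv 𝓘(ℝ, Rn n) (𝓡 n) (extChartAt (𝓡 n) p).symm y w

theorem contMDiffOn_chartField (p : M) (w : Rn n) :
    ContMDiffOn 𝓘(ℝ, Rn n) ((𝓡 n).prod 𝓘(ℝ, Rn n)) ∞
      (fun y => (⟨(extChartAt (𝓡 n) p).symm y, chartField p w y⟩ : TangentBundle (𝓡 n) M))
      (extChartAt (𝓡 n) p).target := by
  have hopen : IsOpen (extChartAt (𝓡 n) p).target := isOpen_extChartAt_target p
  have hs : ContMDiffOn 𝓘(ℝ, Rn n) (𝓡 n) ∞ (extChartAt (𝓡 n) p).symm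
      (extChartAt (𝓡 n) p).target := contMDiffOn_extChartAt_symm p
  have h1 := hs.contMDiffOn_tangentMapWithin (m := ∞) (by simp) hopen.uniqueMDiffOn
  have h2 := (contMDiff_vectorSpace_iff_contDiff (𝕜 := ℝ) (n := ∞)
    (V := fun y : Rn n => (w : TangentSpace 𝓘(ℝ, Rn n) y))).2 contDiff_const
  refine (h1.comp h2.contMDiffOn fun y hy => hy).congr fun y hy => ?_
  simp only [Function.comp, tangentMapWithin, chartField]
  rw [mfderivWithin_of_isOpen hopen hy]

/-- A vector of the model space, read as a tangent vector at `x`. It fixes the point whose metric is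
used, which the defeq `TangentSpace (𝓡 n) x = Rn n` leaves undetermined. -/
def vecAt (x : M) (a : Rn n) : TangentSpace (𝓡 n) x := a

theorem inner_vecAt_congr {x y : M} (h : y = x) (a b : Rn n) :
    (inner ℝ (vecAt y a) (vecAt y b) : ℝ) = inner ℝ (vecAt x a) (vecAt x b) := by
  subst h
  rfl

/-- The derivative of the inverse chart at `x`, at the image of `x` itself, is the identity. -/
theorem mfderiv_extChartAt_symm_self (x : M) :
    (mfderiv 𝓘(ℝ, Rn n) (𝓡 n) (extChartAt (𝓡 n) x).symm (extChartAt (𝓡 n) x x) :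
      Rn n →L[ℝ] Rn n) = ContinuousLinearMap.id ℝ (Rn n) := by
  have h0 := mfderivWithin_range_extChartAt_symm (I := 𝓡 n) (x := x)
  rw [show range (𝓡 n) = (univ : Set (Rn n)) by simp, mfderivWithin_univ] at h0
  exact h0

theorem inner_chartField_self (x : M) (v w : Rn n) :
    inner ℝ (chartField x v (extChartAt (𝓡 n) x x)) (chartField x w (extChartAt (𝓡 n) x x)) =
      (inner ℝ (vecAt x v) (vecAt x w) : ℝ) := by
  have h1 : ∀ u : Rn n, (chartField x u (extChartAt (𝓡 n) x x) : Rn n) = u := fun u =>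
    congrArg (fun L : Rn n →L[ℝ] Rn n => L u) (mfderiv_extChartAt_symm_self x)
  have h2 := inner_vecAt_congr (extChartAt_to_inv (I := 𝓡 n) x)
    (chartField x v (extChartAt (𝓡 n) x x)) (chartField x w (extChartAt (𝓡 n) x x))
  have h3 : (inner ℝ (vecAt x v) (vecAt x w) : ℝ) = inner ℝ
      (vecAt x (chartField x v (extChartAt (𝓡 n) x x)))
      (vecAt x (chartField x w (extChartAt (𝓡 n) x x))) := by rw [h1, h1]
  rw [h3]
  exact h2

/-- The curve through `x` which is a straight line with velocity `v` in the chart at `x`. -/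
def chartLine (x : M) (v : Rn n) (t : ℝ) : M :=
  (extChartAt (𝓡 n) x).symm (extChartAt (𝓡 n) x x + t • v)

theorem chartLine_zero (x : M) (v : Rn n) : chartLine x v 0 = x := by
  rw [chartLine, zero_smul, add_zero, extChartAt_to_inv]

theorem mdifferentiableAt_extChartAt_symm_of_mem (p : M) {y : Rn n}
    (hy : y ∈ (extChartAt (𝓡 n) p).target) :
    MDifferentiableAt 𝓘(ℝ, Rn n) (𝓡 n) (extChartAt (𝓡 n) p).symm y :=
  ((contMDiffOn_extChartAt_symm (n := ∞) p).contMDiffAt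
      ((isOpen_extChartAt_target p).mem_nhds hy)).mdifferentiableAt (by simp)

theorem hasMFDerivAt_chartLine (x : M) (v : Rn n) {t : ℝ}
    (ht : extChartAt (𝓡 n) x x + t • v ∈ (extChartAt (𝓡 n) x).target) :
    HasMFDerivAt 𝓘(ℝ, ℝ) (𝓡 n) (chartLine x v) t
      ((mfderiv 𝓘(ℝ, Rn n) (𝓡 n) (extChartAt (𝓡 n) x).symm
        (extChartAt (𝓡 n) x x + t • v)).comp
        (ContinuousLinearMap.toSpanSingleton ℝ v)) := by
  have h1 : HasFDerivAt (fun t : ℝ => extChartAt (𝓡 n) x x + t • v)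
      (ContinuousLinearMap.toSpanSingleton ℝ v) t :=
    ((ContinuousLinearMap.toSpanSingleton ℝ v).hasFDerivAt).const_add _
  exact (mdifferentiableAt_extChartAt_symm_of_mem x ht).hasMFDerivAt.comp t h1.hasMFDerivAt

/-- The sharp upper bound of the Riemannian distance along a curve with velocity `v` at `x`. -/
theorem eventually_dist_chartLine_le [IsRiemannianManifold (𝓡 n) M]
    (x : M) (v : Rn n) {r : ℝ} (hr : ‖vecAt x v‖ < r) :
    ∀ᶠ t in 𝓝[>] (0 : ℝ), dist x (chartLine x v t) ≤ r * t := by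
  have hopen : IsOpen (extChartAt (𝓡 n) x).target := isOpen_extChartAt_target x
  have hnorm : ContinuousOn (fun y => ‖chartField x v y‖) (extChartAt (𝓡 n) x).target := by
    have := ContinuousOn.inner_bundle (contMDiffOn_chartField x v).continuousOn
      (contMDiffOn_chartField x v).continuousOn
    refine (this.sqrt).congr fun y hy => ?_
    exact norm_eq_sqrt_real_inner _
  have h0 : ‖chartField x v (extChartAt (𝓡 n) x x)‖ = ‖vecAt x v‖ := by
    rw [norm_eq_sqrt_real_inner, inner_chartField_self, ← norm_eq_sqrt_real_inner]
  have hev : ∀ᶠ y in 𝓝 (extChartAt (𝓡 n) x x),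
      y ∈ (extChartAt (𝓡 n) x).target ∧ ‖chartField x v y‖ < r := by
    have hmem := hopen.mem_nhds (mem_extChartAt_target (I := 𝓡 n) x)
    refine Filter.Eventually.and hmem ?_
    refine (hnorm.continuousAt hmem).eventually_lt_const ?_
    exact h0.trans_lt hr
  have hline : Continuous fun t : ℝ => extChartAt (𝓡 n) x x + t • v := by fun_prop
  have hev2 : ∀ᶠ t in 𝓝 (0 : ℝ), extChartAt (𝓡 n) x x + t • v ∈ (extChartAt (𝓡 n) x).target ∧
      ‖chartField x v (extChartAt (𝓡 n) x x + t • v)‖ < r := by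
    have : Tendsto (fun t : ℝ => extChartAt (𝓡 n) x x + t • v) (𝓝 0)
        (𝓝 (extChartAt (𝓡 n) x x)) := by
      simpa using hline.tendsto 0
    exact this.eventually hev
  obtain ⟨δ, hδ, hball⟩ := Metric.eventually_nhds_iff_ball.1 hev2
  have hr0 : 0 ≤ r := (norm_nonneg _).trans hr.le
  filter_upwards [self_mem_nhdsWithin, nhdsWithin_le_nhds (Iio_mem_nhds hδ)] with t ht htδ
  have hgood : ∀ s ∈ Icc (0 : ℝ) t, _ := fun s hs => hball s (by
    rw [Metric.mem_ball, Real.dist_eq, sub_zero, abs_of_nonneg hs.1]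
    exact lt_of_le_of_lt hs.2 htδ)
  have hsm : ContMDiffOn 𝓘(ℝ, ℝ) (𝓡 n) 1 (chartLine x v) (Icc 0 t) := by
    refine (contMDiffOn_extChartAt_symm x).comp
      (f := fun t : ℝ => extChartAt (𝓡 n) x x + t • v) ?_ fun s hs => (hgood s hs).1
    refine ContMDiff.contMDiffOn (contMDiff_iff_contDiff.2 ?_)
    fun_prop
  have h1 : edist x (chartLine x v t) ≤ ENNReal.ofReal (r * t) := by
    rw [IsRiemannianManifold.out (I := 𝓡 n) x]
    refine (riemannianEDist_le_pathELength hsm (chartLine_zero x v) rfl (le_of_lt ht)).trans ?_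
    rw [pathELength_eq_lintegral_mfderiv_Icc]
    calc _ ≤ ∫⁻ _ in Icc (0 : ℝ) t, ENNReal.ofReal r := by
          refine setLIntegral_mono' measurableSet_Icc fun s hs => ?_
          rw [(hasMFDerivAt_chartLine x v (hgood s hs).1).mfderiv, ← ofReal_norm]
          refine ENNReal.ofReal_le_ofReal (le_trans (le_of_eq ?_) (hgood s hs).2.le)
          congr 1
          show (mfderiv 𝓘(ℝ, Rn n) (𝓡 n) (extChartAt (𝓡 n) x).symm
            (extChartAt (𝓡 n) x x + s • v) ((1 : ℝ) • v) : Rn n) = _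
          rw [one_smul]
          rfl
      _ = _ := by
          rw [setLIntegral_const, Real.volume_Icc, sub_zero, ENNReal.ofReal_mul hr0]
  rw [edist_dist] at h1
  exact (ENNReal.ofReal_le_ofReal_iff (mul_nonneg hr0 (le_of_lt ht))).1 h1

theorem differential_linearTest_self (x : M) (e v : TangentSpace (𝓡 n) x) :
    differential (linearTest x e) x v = inner ℝ e v := by
  rw [differential, (hasMFDerivAt_linearTest x e (mem_chart_source _ x)).mfderiv,
    mfderiv_extChartAt_self]
  rfl

theorem hasMFDerivAt_chartLine_zero (x : M) (v : Rn n) :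
    HasMFDerivAt 𝓘(ℝ, ℝ) (𝓡 n) (chartLine x v) 0
      (ContinuousLinearMap.toSpanSingleton ℝ v) := by
  have hz : extChartAt (𝓡 n) x x + (0 : ℝ) • v = extChartAt (𝓡 n) x x := by simp
  have h := hasMFDerivAt_chartLine x v (t := 0) (by rw [hz]; exact mem_extChartAt_target x)
  have h1 : (mfderiv 𝓘(ℝ, Rn n) (𝓡 n) (extChartAt (𝓡 n) x).symm
      (extChartAt (𝓡 n) x x + (0 : ℝ) • v) : Rn n →L[ℝ] Rn n) =
      ContinuousLinearMap.id ℝ (Rn n) := by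
    rw [hz]; exact mfderiv_extChartAt_symm_self x
  have h2 : HasMFDerivAt 𝓘(ℝ, ℝ) (𝓡 n) (chartLine x v) 0 ((mfderiv 𝓘(ℝ, Rn n) (𝓡 n) (extChartAt (𝓡 n) x).symm
      (extChartAt (𝓡 n) x x + (0 : ℝ) • v) : Rn n →L[ℝ] Rn n).comp
        (ContinuousLinearMap.toSpanSingleton ℝ v)) := h
  rw [h1] at h2
  exact h2

/-- A differentiable map which does not increase distances does not increase the length of tangent
vectors. With `e = df(v)`, the derivative at `0` of `linearTest (f x) e` along the image of a curve
of velocity `v` is `‖e‖²`, and it is at most `‖e‖ r s` for all `r > 1` and `s > ‖v‖`. -/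
theorem norm_mfderiv_le_of_lipschitz [IsRiemannianManifold (𝓡 n) M] {f : M → M}
    (hf : LipschitzWith 1 f) {x : M} (hd : MDifferentiableAt (𝓡 n) (𝓡 n) f x)
    (v : TangentSpace (𝓡 n) x) : ‖mfderiv (𝓡 n) (𝓡 n) f x v‖ ≤ ‖v‖ := by
  set e : TangentSpace (𝓡 n) (f x) := mfderiv (𝓡 n) (𝓡 n) f x v with he
  have key : ∀ r : ℝ, 1 < r → ∀ s : ℝ, ‖v‖ < s → ‖e‖ * ‖e‖ ≤ ‖e‖ * r * s := by
    intro r hr s hs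
    let F : ℝ → ℝ := linearTest (f x) e ∘ f ∘ chartLine x v
    have hx0 : chartLine x v 0 = x := chartLine_zero x v
    have hF : HasDerivAt F (‖e‖ * ‖e‖) 0 := by
      have h1 := hasMFDerivAt_chartLine_zero x v
      have h2 : HasMFDerivAt (𝓡 n) (𝓡 n) f (chartLine x v 0)
          (mfderiv (𝓡 n) (𝓡 n) f x : Rn n →L[ℝ] Rn n) := by
        rw [hx0]; exact hd.hasMFDerivAt
      have h3 : HasMFDerivAt (𝓡 n) 𝓘(ℝ, ℝ) (linearTest (f x) e) (f (chartLine x v 0))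
          (differential (linearTest (f x) e) (f x) : Rn n →L[ℝ] ℝ) := by
        rw [hx0]
        exact (hasMFDerivAt_linearTest (f x) e
          (mem_chart_source _ (f x))).mdifferentiableAt.hasMFDerivAt
      have h4 : HasMFDerivAt 𝓘(ℝ, ℝ) 𝓘(ℝ, ℝ) F 0
        (((differential (linearTest (f x) e) (f x) : Rn n →L[ℝ] ℝ).comp
          (mfderiv (𝓡 n) (𝓡 n) f x : Rn n →L[ℝ] Rn n)).comp
          (ContinuousLinearMap.toSpanSingleton ℝ (v : Rn n))) := by
          have := HasMFDerivAt.comp (0 : ℝ) h3 (HasMFDerivAt.comp (0 : ℝ) h2 h1)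
          exact this
      have h5 : HasFDerivAt F
        ((((differential (linearTest (f x) e) (f x) : Rn n →L[ℝ] ℝ).comp
          (mfderiv (𝓡 n) (𝓡 n) f x : Rn n →L[ℝ] Rn n)).comp
          (ContinuousLinearMap.toSpanSingleton ℝ (v : Rn n))) : ℝ →L[ℝ] ℝ) 0 := hasMFDerivAt_iff_hasFDerivAt.1 h4
      have h6 : differential (linearTest (f x) e) (f x)
          (mfderiv (𝓡 n) (𝓡 n) f x ((1 : ℝ) • v)) = ‖e‖ * ‖e‖ := by
        rw [one_smul, ← real_inner_self_eq_norm_mul_norm, ← differential_linearTest_self]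
      rw [← h6]
      exact h5.hasDerivAt
    have hF0 : F 0 = linearTest (f x) e (f x) := by simp [F, hx0]
    have hcont : Tendsto (fun t => f (chartLine x v t)) (𝓝[>] 0) (𝓝 (f x)) := by
      have h1 : ContinuousAt (chartLine x v) 0 := (hasMFDerivAt_chartLine_zero x v).continuousAt
      have h2 := (hf.continuous.continuousAt (x := chartLine x v 0)).comp h1
      have h3 : Tendsto (f ∘ chartLine x v) (𝓝 0) (𝓝 (f x)) := by
        simpa [ContinuousAt, hx0] using h2
      exact h3.mono_left nhdsWithin_le_nhds
    have hslope := (hasDerivAt_iff_tendsto_slope_zero.1 hF).mono_left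
      (nhdsWithin_mono (0 : ℝ) (s := Ioi 0) (fun t ht => ne_of_gt ht))
    refine le_of_tendsto hslope ?_
    filter_upwards [self_mem_nhdsWithin, eventually_dist_chartLine_le x v hs,
      hcont.eventually (eventually_abs_linearTest_sub_le (f x) e hr)] with t ht h1 h2
    have ht' : 0 < t := ht
    rw [zero_add, hF0, smul_eq_mul, inv_mul_le_iff₀ ht']
    have h3 : dist (f x) (f (chartLine x v t)) ≤ s * t := by
      refine (hf.dist_le_mul _ _).trans ?_
      simpa using h1
    calc F t - linearTest (f x) e (f x) ≤ ‖e‖ * r * dist (f x) (f (chartLine x v t)) :=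
          (le_abs_self _).trans h2
      _ ≤ ‖e‖ * r * (s * t) := by gcongr
      _ = _ := by ring
  by_contra! hlt
  obtain ⟨s, hs1, hs2⟩ := exists_between hlt
  have he0 : 0 < ‖e‖ := (norm_nonneg _).trans_lt hlt
  have hs0 : 0 < s := (norm_nonneg _).trans_lt hs1
  obtain ⟨r, hr1, hr2⟩ := exists_between (show 1 < ‖e‖ / s from (one_lt_div hs0).2 hs2)
  have := key r hr1 s hs1
  rw [lt_div_iff₀ hs0] at hr2
  nlinarith

/-- A diffeomorphism which preserves the Riemannian distance is infinitesimally an isometry. -/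
theorem inner_mfderiv_of_isometry [IsRiemannianManifold (𝓡 n) M] (f : M ≃ₘ^∞⟮𝓡 n, 𝓡 n⟯ M)
    (hf : Isometry f) (x : M) (v w : TangentSpace (𝓡 n) x) :
    inner ℝ (mfderiv (𝓡 n) (𝓡 n) f x v) (mfderiv (𝓡 n) (𝓡 n) f x w) = (inner ℝ v w : ℝ) := by
  have hnorm : ∀ u : TangentSpace (𝓡 n) x, ‖mfderiv (𝓡 n) (𝓡 n) f x u‖ = ‖u‖ := by
    intro u
    refine le_antisymm (norm_mfderiv_le_of_lipschitz hf.lipschitz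
      (f.contMDiff.mdifferentiableAt (by simp)) u) ?_
    have hsymm : LipschitzWith 1 f.symm := by
      refine LipschitzWith.of_edist_le fun a b => ?_
      rw [← hf.edist_eq, f.apply_symm_apply, f.apply_symm_apply]
    have h1 := norm_mfderiv_le_of_lipschitz hsymm
      (f.symm.contMDiff.mdifferentiableAt (by simp) (x := f x)) (mfderiv (𝓡 n) (𝓡 n) f x u)
    refine le_trans (le_of_eq ?_) h1
    have h2 : HasMFDerivAt (𝓡 n) (𝓡 n) (f.symm ∘ f) x
        ((mfderiv (𝓡 n) (𝓡 n) f.symm (f x)).comp (mfderiv (𝓡 n) (𝓡 n) f x)) :=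
      (f.symm.contMDiff.mdifferentiableAt (by simp) (x := f x)).hasMFDerivAt.comp x
        (f.contMDiff.mdifferentiableAt (by simp)).hasMFDerivAt
    have h3 : (f.symm ∘ f : M → M) = id := funext f.symm_apply_apply
    rw [h3] at h2
    have h2' : HasMFDerivAt (𝓡 n) (𝓡 n) (id : M → M) x
        ((mfderiv (𝓡 n) (𝓡 n) f.symm (f x)).comp (mfderiv (𝓡 n) (𝓡 n) f x) :
          Rn n →L[ℝ] Rn n) := h2
    have h4 : ((mfderiv (𝓡 n) (𝓡 n) f.symm (f x)).comp (mfderiv (𝓡 n) (𝓡 n) f x) :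
        Rn n →L[ℝ] Rn n) = ContinuousLinearMap.id ℝ (Rn n) :=
      hasMFDerivAt_unique (x := x) (f := (id : M → M)) h2' (hasMFDerivAt_id x)
    have h5 : (mfderiv (𝓡 n) (𝓡 n) f.symm (f x) (mfderiv (𝓡 n) (𝓡 n) f x u) : Rn n) = u :=
      congrArg (fun L : Rn n →L[ℝ] Rn n => L u) h4
    have h6 := inner_vecAt_congr (f.symm_apply_apply x)
      (mfderiv (𝓡 n) (𝓡 n) f.symm (f x) (mfderiv (𝓡 n) (𝓡 n) f x u))
      (mfderiv (𝓡 n) (𝓡 n) f.symm (f x) (mfderiv (𝓡 n) (𝓡 n) f x u))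
    have h7 : (inner ℝ u u : ℝ) = inner ℝ (vecAt x u) (vecAt x u) := rfl
    rw [norm_eq_sqrt_real_inner, norm_eq_sqrt_real_inner, h7]
    congr 1
    refine Eq.trans ?_ h6.symm
    rw [h5]
  rw [real_inner_eq_norm_add_mul_self_sub_norm_mul_self_sub_norm_mul_self_div_two,
    real_inner_eq_norm_add_mul_self_sub_norm_mul_self_sub_norm_mul_self_div_two, hnorm, hnorm,
    ← map_add, hnorm]

end Infinitesimal

/-! ### The metric in two charts related by an isometry -/

section Volume

variable {n : ℕ} {M : Type*} [MetricSpace M] [ChartedSpace (Rn n) M] [IsManifold (𝓡 n) ∞ M]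
  [RiemannianBundle (fun x : M => TangentSpace (𝓡 n) x)]
  [IsContMDiffRiemannianBundle (𝓡 n) ∞ (Rn n) (fun x : M => TangentSpace (𝓡 n) x)]

/-- The map `f` read in the charts at `p` (source) and `q` (target). -/
def inCharts (f : M → M) (p q : M) (y : Rn n) : Rn n :=
  extChartAt (𝓡 n) q (f ((extChartAt (𝓡 n) p).symm y))

/-- The coordinates, in the chart at `p`, of the points of the chart domain which `f` maps to the
domain of the chart at `q`. -/
def chartOverlap (f : M → M) (p q : M) : Set (Rn n) :=
  (extChartAt (𝓡 n) p).target ∩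
    (fun y => f ((extChartAt (𝓡 n) p).symm y)) ⁻¹' (extChartAt (𝓡 n) q).source

theorem isOpen_chartOverlap (f : M ≃ₘ^∞⟮𝓡 n, 𝓡 n⟯ M) (p q : M) :
    IsOpen (chartOverlap (n := n) f p q) := by
  refine ContinuousOn.isOpen_inter_preimage ?_ (isOpen_extChartAt_target p)
    (isOpen_extChartAt_source q)
  exact f.continuous.comp_continuousOn (continuousOn_extChartAt_symm p)

theorem contDiffOn_inCharts (f : M ≃ₘ^∞⟮𝓡 n, 𝓡 n⟯ M) (p q : M) :
    ContDiffOn ℝ ∞ (inCharts (n := n) f p q) (chartOverlap (n := n) f p q) := by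
  rw [← contMDiffOn_iff_contDiffOn]
  have h1 : ContMDiffOn 𝓘(ℝ, Rn n) (𝓡 n) ∞ (fun y => f ((extChartAt (𝓡 n) p).symm y))
      (chartOverlap (n := n) f p q) :=
    f.contMDiff.comp_contMDiffOn ((contMDiffOn_extChartAt_symm p).mono inter_subset_left)
  refine (contMDiffOn_extChartAt (x := q)).comp h1 fun y hy => ?_
  simpa using hy.2

theorem contDiffAt_inCharts (f : M ≃ₘ^∞⟮𝓡 n, 𝓡 n⟯ M) (p q : M) {y : Rn n}
    (hy : y ∈ chartOverlap (n := n) f p q) : ContDiffAt ℝ ∞ (inCharts (n := n) f p q) y :=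
  (contDiffOn_inCharts f p q).contDiffAt ((isOpen_chartOverlap f p q).mem_nhds hy)

theorem extChartAt_symm_inCharts (f : M → M) (p q : M) {y : Rn n}
    (hy : y ∈ chartOverlap (n := n) f p q) :
    (extChartAt (𝓡 n) q).symm (inCharts f p q y) = f ((extChartAt (𝓡 n) p).symm y) :=
  (extChartAt (𝓡 n) q).left_inv hy.2

theorem inCharts_mem_target (f : M → M) (p q : M) {y : Rn n}
    (hy : y ∈ chartOverlap (n := n) f p q) : inCharts f p q y ∈ (extChartAt (𝓡 n) q).target :=
  (extChartAt (𝓡 n) q).map_source hy.2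

/-- A diffeomorphism maps the field with coordinates `w` to the field whose coordinates are the
image of `w` by the derivative of the coordinate expression. -/
theorem chartField_inCharts (f : M ≃ₘ^∞⟮𝓡 n, 𝓡 n⟯ M) (p q : M) {y : Rn n}
    (hy : y ∈ chartOverlap (n := n) f p q) (w : Rn n) :
    (chartField q (fderiv ℝ (inCharts (n := n) f p q) y w) (inCharts f p q y) : Rn n) =
      mfderiv (𝓡 n) (𝓡 n) f ((extChartAt (𝓡 n) p).symm y) (chartField p w y) := by
  have hT : HasMFDerivAt 𝓘(ℝ, Rn n) 𝓘(ℝ, Rn n) (inCharts f p q) y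
      (fderiv ℝ (inCharts (n := n) f p q) y) :=
    ((contDiffAt_inCharts f p q hy).differentiableAt (by simp)).hasFDerivAt.hasMFDerivAt
  have h1 := (mdifferentiableAt_extChartAt_symm_of_mem q
    (inCharts_mem_target f p q hy)).hasMFDerivAt.comp y hT
  have h2 := (f.contMDiff.mdifferentiableAt (by simp)
    (x := (extChartAt (𝓡 n) p).symm y)).hasMFDerivAt.comp y
      (mdifferentiableAt_extChartAt_symm_of_mem p hy.1).hasMFDerivAt
  have h3 : (extChartAt (𝓡 n) q).symm ∘ inCharts f p q =ᶠ[𝓝 y] f ∘ (extChartAt (𝓡 n) p).symm := by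
    filter_upwards [(isOpen_chartOverlap f p q).mem_nhds hy] with z hz
    exact extChartAt_symm_inCharts f p q hz
  have h1' : HasMFDerivAt 𝓘(ℝ, Rn n) (𝓡 n) (f ∘ (extChartAt (𝓡 n) p).symm) y
      ((mfderiv 𝓘(ℝ, Rn n) (𝓡 n) (extChartAt (𝓡 n) q).symm (inCharts f p q y) :
        Rn n →L[ℝ] Rn n).comp (fderiv ℝ (inCharts (n := n) f p q) y)) :=
    h1.congr_of_eventuallyEq h3.symm
  have h4 := hasMFDerivAt_unique h1' h2
  exact congrArg (fun L : Rn n →L[ℝ] Rn n => L w) h4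

theorem inner_chartField_inCharts [IsRiemannianManifold (𝓡 n) M] (f : M ≃ₘ^∞⟮𝓡 n, 𝓡 n⟯ M)
    (hf : Isometry f) (p q : M) {y : Rn n} (hy : y ∈ chartOverlap (n := n) f p q) (v w : Rn n) :
    (inner ℝ (chartField q (fderiv ℝ (inCharts (n := n) f p q) y v) (inCharts f p q y))
      (chartField q (fderiv ℝ (inCharts (n := n) f p q) y w) (inCharts f p q y)) : ℝ) =
      inner ℝ (chartField p v y) (chartField p w y) := by
  rw [← inner_mfderiv_of_isometry f hf _ (chartField p v y)]
  have h := inner_vecAt_congr (extChartAt_symm_inCharts f p q hy)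
    (chartField q (fderiv ℝ (inCharts (n := n) f p q) y v) (inCharts f p q y))
    (chartField q (fderiv ℝ (inCharts (n := n) f p q) y w) (inCharts f p q y))
  refine Eq.trans h ?_
  rw [chartField_inCharts f p q hy, chartField_inCharts f p q hy]
  rfl

theorem sum_smul_single (v : Rn n) : ∑ i, v i • EuclideanSpace.single i (1 : ℝ) = v := by
  simpa using (EuclideanSpace.basisFun (Fin n) ℝ).sum_repr v

theorem chartField_sum (p : M) (y : Rn n) (c : Fin n → ℝ) :
    chartField p (∑ i, c i • EuclideanSpace.single i (1 : ℝ)) y = ∑ i, c i • coordVec n p i y := by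
  have h : ∀ L : Rn n →L[ℝ] TangentSpace (𝓡 n) ((extChartAt (𝓡 n) p).symm y),
      L (∑ i, c i • EuclideanSpace.single i (1 : ℝ)) =
        ∑ i, c i • L (EuclideanSpace.single i (1 : ℝ)) := fun L => by
    rw [map_sum]
    exact Finset.sum_congr rfl fun i _ => map_smul L _ _
  exact h _

theorem inner_chartField_eq_gramMatrix (p : M) (y : Rn n) (v w : Rn n) :
    (inner ℝ (chartField p v y) (chartField p w y) : ℝ) =
      ∑ i, ∑ j, v i * gramMatrix n p y i j * w j := by
  conv_lhs => rw [← sum_smul_single v, ← sum_smul_single w, chartField_sum, chartField_sum]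
  simp_rw [sum_inner, inner_sum, real_inner_smul_left, real_inner_smul_right]
  refine Finset.sum_congr rfl fun i _ => Finset.sum_congr rfl fun j _ => ?_
  simp only [gramMatrix, Matrix.of_apply]
  ring

/-- The Gram determinants of two charts are related by the square of the Jacobian of an isometry. -/
theorem gramMatrix_inCharts [IsRiemannianManifold (𝓡 n) M] (f : M ≃ₘ^∞⟮𝓡 n, 𝓡 n⟯ M)
    (hf : Isometry f) (p q : M) {y : Rn n} (hy : y ∈ chartOverlap (n := n) f p q) :
    (gramMatrix n p y).det = (fderiv ℝ (inCharts (n := n) f p q) y).det ^ 2 *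
      (gramMatrix n q (inCharts f p q y)).det := by
  set L := fderiv ℝ (inCharts (n := n) f p q) y with hL
  set b := (EuclideanSpace.basisFun (Fin n) ℝ).toBasis
  set J := LinearMap.toMatrix b b (L : Rn n →ₗ[ℝ] Rn n) with hJ
  have hJent : ∀ i k, J k i = L (EuclideanSpace.single i (1 : ℝ)) k := by
    intro i k
    simp [hJ, LinearMap.toMatrix_apply, b]
  have hG : gramMatrix n p y = J.transpose * gramMatrix n q (inCharts f p q y) * J := by
    ext i j
    have h1 : gramMatrix n p y i j = inner ℝ (chartField p (EuclideanSpace.single i (1 : ℝ)) y)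
        (chartField p (EuclideanSpace.single j (1 : ℝ)) y) := rfl
    rw [h1, ← inner_chartField_inCharts f hf p q hy, inner_chartField_eq_gramMatrix,
      Matrix.mul_apply]
    simp_rw [Matrix.mul_apply, Finset.sum_mul, Matrix.transpose_apply, hJent]
    rw [Finset.sum_comm]
  have hdet : L.det = J.det := by
    rw [hJ, LinearMap.det_toMatrix]
  rw [hG, Matrix.det_mul, Matrix.det_mul, Matrix.det_transpose, hdet]
  ring

end Volume

/-! ### Invariance of the Riemannian volume -/

section VolumeInvariance

variable {n : ℕ} {M : Type*} [MetricSpace M] [ChartedSpace (Rn n) M] [IsManifold (𝓡 n) ∞ M]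
  [RiemannianBundle (fun x : M => TangentSpace (𝓡 n) x)]
  [IsContMDiffRiemannianBundle (𝓡 n) ∞ (Rn n) (fun x : M => TangentSpace (𝓡 n) x)]
  [CompactSpace M] [MeasurableSpace M] [BorelSpace M]

theorem aemeasurable_extChartAt_symm (p : M) :
    AEMeasurable (extChartAt (𝓡 n) p).symm
      (volume.restrict (extChartAt (𝓡 n) p).target) :=
  (continuousOn_extChartAt_symm p).aemeasurable (isOpen_extChartAt_target p).measurableSet

theorem lintegral_chartVolume (p : M) {g : M → ℝ≥0∞} (hg : Measurable g) :
    ∫⁻ x, g x ∂(chartVolume n p) = ∫⁻ y in (extChartAt (𝓡 n) p).target,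
      ENNReal.ofReal (Real.sqrt (gramMatrix n p y).det) * g ((extChartAt (𝓡 n) p).symm y) := by
  have hs := aemeasurable_extChartAt_symm (n := n) p
  have hd : AEMeasurable (fun y => ENNReal.ofReal (Real.sqrt (gramMatrix n p y).det))
      (volume.restrict (extChartAt (𝓡 n) p).target) :=
    ((continuousOn_gramMatrix_det n p).sqrt.aemeasurable
      (isOpen_extChartAt_target p).measurableSet).ennreal_ofReal
  rw [chartVolume, lintegral_map' hg.aemeasurable
    (hs.mono_ac (withDensity_absolutelyContinuous _ _))]
  exact lintegral_withDensity_eq_lintegral_mul₀ hd (hg.comp_aemeasurable hs)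

theorem image_inCharts_chartOverlap (f : M ≃ₘ^∞⟮𝓡 n, 𝓡 n⟯ M) (p q : M) :
    inCharts (n := n) f p q '' chartOverlap (n := n) f p q =
      chartOverlap (n := n) f.symm q p := by
  ext z
  constructor
  · rintro ⟨y, hy, rfl⟩
    refine ⟨inCharts_mem_target f p q hy, ?_⟩
    rw [mem_preimage, extChartAt_symm_inCharts f p q hy, f.symm_apply_apply]
    exact (extChartAt (𝓡 n) p).map_target hy.1
  · intro hz
    have h1 : f ((extChartAt (𝓡 n) p).symm (inCharts f.symm q p z)) =
        (extChartAt (𝓡 n) q).symm z := by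
      rw [extChartAt_symm_inCharts f.symm q p hz, f.apply_symm_apply]
    refine ⟨inCharts f.symm q p z, ⟨inCharts_mem_target f.symm q p hz, ?_⟩, ?_⟩
    · rw [mem_preimage, h1]
      exact (extChartAt (𝓡 n) q).map_target hz.1
    · rw [inCharts, h1]
      exact (extChartAt (𝓡 n) q).right_inv hz.1

theorem injOn_inCharts (f : M ≃ₘ^∞⟮𝓡 n, 𝓡 n⟯ M) (p q : M) :
    InjOn (inCharts (n := n) f p q) (chartOverlap (n := n) f p q) := by
  intro y hy z hz h
  have h1 := extChartAt_symm_inCharts f p q hy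
  rw [h, extChartAt_symm_inCharts f p q hz] at h1
  exact ((extChartAt (𝓡 n) p).symm.injOn hz.1 hy.1 (f.injective h1)).symm

theorem setLIntegral_chartOverlap (f : M ≃ₘ^∞⟮𝓡 n, 𝓡 n⟯ M) (p q : M) {g : Rn n → ℝ≥0∞}
    (hg : ∀ y, f ((extChartAt (𝓡 n) p).symm y) ∉ (extChartAt (𝓡 n) q).source → g y = 0) :
    ∫⁻ y in (extChartAt (𝓡 n) p).target, g y = ∫⁻ y in chartOverlap (n := n) f p q, g y := by
  have hA : MeasurableSet (chartOverlap (n := n) f p q) := (isOpen_chartOverlap f p q).measurableSet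
  rw [← lintegral_inter_add_sdiff g (extChartAt (𝓡 n) p).target hA,
    inter_eq_self_of_subset_right (s := (extChartAt (𝓡 n) p).target)
      (t := chartOverlap (n := n) f p q) inter_subset_left]
  rw [setLIntegral_eq_zero ((isOpen_extChartAt_target p).measurableSet.diff hA)
    fun y hy => hg y fun h => hy.2 ⟨hy.1, h⟩, add_zero]

/-- Change of variables between the chart volumes, under an isometry. -/
theorem lintegral_comp_chartVolume [IsRiemannianManifold (𝓡 n) M] (f : M ≃ₘ^∞⟮𝓡 n, 𝓡 n⟯ M)
    (hf : Isometry f) (p q : M) {g : M → ℝ≥0∞} (hg : Measurable g)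
    (hp : ∀ x, f.symm x ∉ (extChartAt (𝓡 n) p).source → g x = 0)
    (hq : ∀ x ∉ (extChartAt (𝓡 n) q).source, g x = 0) :
    ∫⁻ x, g (f x) ∂(chartVolume n p) = ∫⁻ x, g x ∂(chartVolume n q) := by
  have hA : MeasurableSet (chartOverlap (n := n) f p q) := (isOpen_chartOverlap f p q).measurableSet
  rw [lintegral_chartVolume p (g := fun x => g (f x)) (hg.comp f.continuous.measurable),
    lintegral_chartVolume q hg]
  rw [setLIntegral_chartOverlap f p q fun y hy => by rw [hq _ hy, mul_zero],
    setLIntegral_chartOverlap f.symm q p fun y hy => by rw [hp _ hy, mul_zero],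
    ← image_inCharts_chartOverlap,
    lintegral_image_eq_lintegral_abs_det_fderiv_mul volume hA
      (fun y hy => ((contDiffAt_inCharts f p q hy).differentiableAt
        (by simp)).hasFDerivAt.hasFDerivWithinAt) (injOn_inCharts f p q)]
  refine setLIntegral_congr_fun hA fun y hy => ?_
  rw [extChartAt_symm_inCharts f p q hy, gramMatrix_inCharts f hf p q hy, ← mul_assoc,
    ← ENNReal.ofReal_mul (abs_nonneg _), Real.sqrt_mul (sq_nonneg _), Real.sqrt_sq_eq_abs]

theorem measurable_chartPartition (p : M) : Measurable fun x => ENNReal.ofReal (chartPartition n M p x) :=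
  (chartPartition n M p).contMDiff.continuous.measurable.ennreal_ofReal

variable (n M) in
theorem finite_chartPartition :
    {p : M | (Function.support (chartPartition n M p)).Nonempty}.Finite :=
  (chartPartition n M).locallyFinite.finite_nonempty_of_compact

theorem chartPartition_eq_zero_of_notMem (p : M) {x : M}
    (hx : x ∉ (extChartAt (𝓡 n) p).source) : chartPartition n M p x = 0 := by
  have hsub := (SmoothPartitionOfUnity.exists_isSubordinate_chartAt_source (𝓡 n) M).choose_spec
  refine image_eq_zero_of_notMem_tsupport fun h => hx ?_
  rw [extChartAt_source]
  exact hsub p h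

theorem sum_chartPartition (x : M) :
    ∑ p ∈ (finite_chartPartition n M).toFinset, ENNReal.ofReal (chartPartition n M p x) = 1 := by
  rw [← ENNReal.ofReal_sum_of_nonneg fun p _ => (chartPartition n M).nonneg p x]
  have h := (chartPartition n M).sum_eq_one (mem_univ x)
  rw [finsum_eq_sum_of_support_subset (s := (finite_chartPartition n M).toFinset)] at h
  · rw [h, ENNReal.ofReal_one]
  · intro p hp
    exact (finite_chartPartition n M).mem_toFinset.2 ⟨x, hp⟩

theorem lintegral_riemannianVolume {g : M → ℝ≥0∞} (hg : Measurable g) :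
    ∫⁻ x, g x ∂(riemannianVolume n M) = ∑ p ∈ (finite_chartPartition n M).toFinset,
      ∫⁻ x, ENNReal.ofReal (chartPartition n M p x) * g x ∂(chartVolume n p) := by
  rw [riemannianVolume, lintegral_sum_measure, tsum_eq_sum (s := (finite_chartPartition n M).toFinset)]
  · refine Finset.sum_congr rfl fun p _ => ?_
    exact lintegral_withDensity_eq_lintegral_mul _ (measurable_chartPartition p) hg
  · intro p hp
    have : ∀ x, chartPartition n M p x = 0 := by
      intro x
      by_contra hx
      exact hp ((finite_chartPartition n M).mem_toFinset.2 ⟨x, hx⟩)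
    simp [this]

/-- Isometries preserve the Riemannian volume. -/
theorem measurePreserving_of_isometry [IsRiemannianManifold (𝓡 n) M] (f : M ≃ₘ^∞⟮𝓡 n, 𝓡 n⟯ M)
    (hf : Isometry f) : MeasurePreserving f (riemannianVolume n M) (riemannianVolume n M) := by
  have hfm : Measurable f := f.continuous.measurable
  refine ⟨hfm, Measure.ext_of_lintegral _ fun g hg => ?_⟩
  rw [lintegral_map hg hfm, lintegral_riemannianVolume (g := fun x => g (f x)) (hg.comp hfm),
    lintegral_riemannianVolume hg]
  set S := (finite_chartPartition n M).toFinset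
  -- the partition of unity transported by `f`, together with the original one, localizes `g` to the
  -- points where a chart and the image of a chart are both available
  let G : M → M → M → ℝ≥0∞ := fun p q x => ENNReal.ofReal (chartPartition n M p (f.symm x)) *
    (ENNReal.ofReal (chartPartition n M q x) * g x)
  have hG : ∀ p q, Measurable (G p q) := fun p q =>
    ((measurable_chartPartition p).comp f.symm.continuous.measurable).mul
      ((measurable_chartPartition q).mul hg)
  calc ∑ p ∈ S, ∫⁻ x, ENNReal.ofReal (chartPartition n M p x) * g (f x) ∂(chartVolume n p)
      = ∑ p ∈ S, ∑ q ∈ S, ∫⁻ x, G p q (f x) ∂(chartVolume n p) := by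
        refine Finset.sum_congr rfl fun p _ => ?_
        rw [← lintegral_finsetSum (f := fun q x => G p q (f x)) _ fun q _ => (hG p q).comp hfm]
        refine lintegral_congr fun x => ?_
        simp only [G, f.symm_apply_apply]
        rw [← Finset.mul_sum, ← Finset.sum_mul, sum_chartPartition, one_mul]
    _ = ∑ p ∈ S, ∑ q ∈ S, ∫⁻ x, G p q x ∂(chartVolume n q) := by
        refine Finset.sum_congr rfl fun p _ => Finset.sum_congr rfl fun q _ =>
          lintegral_comp_chartVolume f hf p q (hG p q) (fun x hx => ?_) fun x hx => ?_
        · simp [G, chartPartition_eq_zero_of_notMem p hx]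
        · simp [G, chartPartition_eq_zero_of_notMem q hx]
    _ = ∑ q ∈ S, ∫⁻ x, ENNReal.ofReal (chartPartition n M q x) * g x ∂(chartVolume n q) := by
        rw [Finset.sum_comm]
        refine Finset.sum_congr rfl fun q _ => ?_
        rw [← lintegral_finsetSum _ fun p _ => hG p q]
        refine lintegral_congr fun x => ?_
        simp only [G]
        rw [← Finset.sum_mul, sum_chartPartition, one_mul]

theorem integral_comp_isometry [IsRiemannianManifold (𝓡 n) M] (f : M ≃ₘ^∞⟮𝓡 n, 𝓡 n⟯ M)
    (hf : Isometry f) (g : M → ℝ) :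
    ∫ x, g (f x) ∂(riemannianVolume n M) = ∫ x, g x ∂(riemannianVolume n M) :=
  (measurePreserving_of_isometry f hf).integral_comp f.toHomeomorph.measurableEmbedding g

end VolumeInvariance

/-! ### Push-forward of vector fields -/

section PushForward

variable {n : ℕ} {M : Type*} [MetricSpace M] [ChartedSpace (Rn n) M] [IsManifold (𝓡 n) ∞ M]
  [RiemannianBundle (fun x : M => TangentSpace (𝓡 n) x)]
  [IsContMDiffRiemannianBundle (𝓡 n) ∞ (Rn n) (fun x : M => TangentSpace (𝓡 n) x)]
  [CompactSpace M] [MeasurableSpace M] [BorelSpace M]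

theorem SmoothVF.ext {v w : SmoothVF n M} (h : ∀ x, (v x : Rn n) = w x) : v = w :=
  ContMDiffSection.ext h

theorem pushSmooth_apply (f : M ≃ₘ^∞⟮𝓡 n, 𝓡 n⟯ M) (v : SmoothVF n M) (x : M) :
    (pushSmooth f v) x = pushField f v x := rfl

theorem mfderiv_apply_congr_point (f : M → M) {x y : M} (h : x = y) (a : Rn n) :
    (mfderiv (𝓡 n) (𝓡 n) f x a : Rn n) = mfderiv (𝓡 n) (𝓡 n) f y a := by
  subst h
  rfl

theorem SmoothVF.congr_point (v : SmoothVF n M) {x y : M} (h : x = y) : (v x : Rn n) = v y := by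
  subst h
  rfl

theorem pushField_apply_image (f : M ≃ₘ^∞⟮𝓡 n, 𝓡 n⟯ M) (v : SmoothVF n M) (x : M) :
    (pushField f v (f x) : Rn n) = mfderiv (𝓡 n) (𝓡 n) f x (v x) := by
  show (mfderiv (𝓡 n) (𝓡 n) f (f.symm (f x)) (v (f.symm (f x))) : Rn n) = _
  rw [v.congr_point (f.symm_apply_apply x)]
  exact mfderiv_apply_congr_point f (f.symm_apply_apply x) _

theorem pushSmooth_trans (f g : M ≃ₘ^∞⟮𝓡 n, 𝓡 n⟯ M) (v : SmoothVF n M) :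
    pushSmooth (g.trans f) v = pushSmooth f (pushSmooth g v) := by
  refine SmoothVF.ext fun x => ?_
  obtain ⟨y, rfl⟩ := (g.trans f).surjective x
  have h1 : HasMFDerivAt (𝓡 n) (𝓡 n) (g.trans f) y
      ((mfderiv (𝓡 n) (𝓡 n) f (g y)).comp (mfderiv (𝓡 n) (𝓡 n) g y)) :=
    (f.contMDiff.mdifferentiableAt (by simp)).hasMFDerivAt.comp y
      (g.contMDiff.mdifferentiableAt (by simp)).hasMFDerivAt
  have h2 : (pushField (g.trans f) v (g.trans f y) : Rn n) =
      mfderiv (𝓡 n) (𝓡 n) f (g y) (mfderiv (𝓡 n) (𝓡 n) g y (v y)) := by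
    rw [pushField_apply_image, h1.mfderiv]
    rfl
  have h3 := pushField_apply_image f (pushSmooth g v) (g y)
  have h4 : ((pushSmooth g v) (g y) : Rn n) = mfderiv (𝓡 n) (𝓡 n) g y (v y) :=
    pushField_apply_image g v y
  rw [h4] at h3
  exact h2.trans h3.symm

theorem pushSmooth_eq_self {f : M ≃ₘ^∞⟮𝓡 n, 𝓡 n⟯ M} (hf : ∀ x, f x = x) (v : SmoothVF n M) :
    pushSmooth f v = v := by
  refine SmoothVF.ext fun x => ?_
  have h1 : (f : M → M) = id := funext hf
  have h2 : ∀ g : M → M, g = id → (mfderiv (𝓡 n) (𝓡 n) g x (v x) : Rn n) = v x := by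
    rintro _ rfl
    rw [mfderiv_id]
    rfl
  have h3 := pushField_apply_image f v x
  rw [h2 f h1] at h3
  rw [← h3, pushSmooth_apply]
  have h4 : ((pushSmooth f v) x : Rn n) = (pushSmooth f v) (f x) :=
    SmoothVF.congr_point _ (hf x).symm
  exact h4

theorem pushSmooth_pushSmooth_symm (f : M ≃ₘ^∞⟮𝓡 n, 𝓡 n⟯ M) (v : SmoothVF n M) :
    pushSmooth f (pushSmooth f.symm v) = v := by
  rw [← pushSmooth_trans]
  exact pushSmooth_eq_self (fun x => f.apply_symm_apply x) v

theorem denseRange_toL2 : DenseRange (toL2 n M) :=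
  UniformSpace.Completion.denseRange_coe

theorem norm_toL2 (v : SmoothVF n M) : ‖toL2 n M v‖ = ‖v‖ :=
  UniformSpace.Completion.norm_coe v

theorem inner_toL2 (v w : SmoothVF n M) : (inner ℝ (toL2 n M v) (toL2 n M w) : ℝ) = inner ℝ v w :=
  UniformSpace.Completion.inner_coe v w

variable [IsRiemannianManifold (𝓡 n) M]

theorem inner_pushField (f : M ≃ₘ^∞⟮𝓡 n, 𝓡 n⟯ M) (hf : Isometry f) (v w : SmoothVF n M) (x : M) :
    (inner ℝ (pushField f v (f x)) (pushField f w (f x)) : ℝ) = inner ℝ (v x) (w x) := by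
  rw [← inner_mfderiv_of_isometry f hf x (v x) (w x)]
  have h : (inner ℝ (pushField f v (f x)) (pushField f w (f x)) : ℝ) =
      inner ℝ (vecAt (f x) (pushField f v (f x))) (vecAt (f x) (pushField f w (f x))) := rfl
  rw [h, pushField_apply_image, pushField_apply_image]
  rfl

theorem inner_pushSmooth (f : M ≃ₘ^∞⟮𝓡 n, 𝓡 n⟯ M) (hf : Isometry f) (v w : SmoothVF n M) :
    (inner ℝ (pushSmooth f v) (pushSmooth f w) : ℝ) = inner ℝ v w := by
  show ∫ x, inner ℝ ((pushSmooth f v) x) ((pushSmooth f w) x) ∂(riemannianVolume n M) =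
    ∫ x, inner ℝ (v x) (w x) ∂(riemannianVolume n M)
  rw [← integral_comp_isometry f hf]
  exact integral_congr_ae (.of_forall fun x => inner_pushField f hf v w x)

/-- `pushL2` extends `pushSmooth`; this needs the bound on the norm given by the invariance of the
scalar product, since `extendOfNorm` is a junk value for an unbounded map. -/
theorem pushL2_toL2 (f : M ≃ₘ^∞⟮𝓡 n, 𝓡 n⟯ M) (hf : Isometry f) (v : SmoothVF n M) :
    pushL2 f (toL2 n M v) = toL2 n M (pushSmooth f v) := by
  refine LinearMap.extendOfNorm_eq denseRange_toL2 ⟨1, fun w => ?_⟩ v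
  rw [one_mul, LinearMap.comp_apply, norm_toL2, norm_toL2, norm_eq_sqrt_real_inner,
    norm_eq_sqrt_real_inner, inner_pushSmooth f hf]

theorem inner_pushL2 (f : M ≃ₘ^∞⟮𝓡 n, 𝓡 n⟯ M) (hf : Isometry f) (u v : L2VF n M) :
    (inner ℝ (pushL2 f u) (pushL2 f v) : ℝ) = inner ℝ u v := by
  refine denseRange_toL2.induction_on₂ (p := fun u v =>
    (inner ℝ (pushL2 f u) (pushL2 f v) : ℝ) = inner ℝ u v) ?_ (fun v w => ?_) u v
  · exact isClosed_eq (by fun_prop) (by fun_prop)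
  · rw [pushL2_toL2 f hf, pushL2_toL2 f hf, inner_toL2, inner_toL2, inner_pushSmooth f hf]

namespace IsometricAction

variable {G : Type*} [Group G] (ρ : IsometricAction n M G)

theorem toDiffeo_one (x : M) : ρ.toDiffeo 1 x = x := by
  have h := ρ.map_mul 1 1 x
  rw [mul_one] at h
  exact ((ρ.toDiffeo 1).injective h).symm

theorem push_toL2 (a : G) (v : SmoothVF n M) :
    ρ.push a (toL2 n M v) = toL2 n M (pushSmooth (ρ.toDiffeo a) v) :=
  pushL2_toL2 _ (ρ.isometry a) v

theorem push_mul_apply (a b : G) (u : L2VF n M) : ρ.push (a * b) u = ρ.push a (ρ.push b u) := by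
  refine denseRange_toL2.induction_on (p := fun u =>
    ρ.push (a * b) u = ρ.push a (ρ.push b u)) u ?_ fun v => ?_
  · exact isClosed_eq (by fun_prop) (by fun_prop)
  · have h : ρ.toDiffeo (a * b) = (ρ.toDiffeo b).trans (ρ.toDiffeo a) :=
      Diffeomorph.ext fun x => ρ.map_mul a b x
    rw [push_toL2, push_toL2, push_toL2, h, pushSmooth_trans]

theorem push_one_apply (u : L2VF n M) : ρ.push 1 u = u := by
  refine denseRange_toL2.induction_on (p := fun u => ρ.push 1 u = u) u ?_ fun v => ?_
  · exact isClosed_eq (by fun_prop) (by fun_prop)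
  · rw [push_toL2, pushSmooth_eq_self ρ.toDiffeo_one]

theorem inner_push_left (a : G) (u v : L2VF n M) :
    (inner ℝ (ρ.push a u) v : ℝ) = inner ℝ u (ρ.push a⁻¹ v) := by
  rw [← inner_pushL2 _ (ρ.isometry a) u]
  show _ = (inner ℝ (ρ.push a u) (ρ.push a (ρ.push a⁻¹ v)) : ℝ)
  rw [← push_mul_apply, mul_inv_cancel, push_one_apply]

end IsometricAction

end PushForward

/-! ### Sums over orthonormal bases -/

section OrthonormalSums

variable {V : Type*} [NormedAddCommGroup V] [InnerProductSpace ℝ V]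
  {ι κ : Type*} [Fintype ι] [Fintype κ]

/-- The trace of a bilinear form with respect to the scalar product does not depend on the
orthonormal basis. -/
theorem sum_bilin_orthonormalBasis_eq (e : OrthonormalBasis ι ℝ V) (e' : OrthonormalBasis κ ℝ V)
    (β : V →ₗ[ℝ] V →ₗ[ℝ] ℝ) : ∑ k, β (e' k) (e' k) = ∑ i, β (e i) (e i) := by
  classical
  have h1 : ∀ k, β (e' k) (e' k) =
      ∑ i, ∑ j, inner ℝ (e i) (e' k) * inner ℝ (e' k) (e j) * β (e i) (e j) := by
    intro k
    conv_lhs => rw [← e.sum_repr' (e' k)]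
    simp only [map_sum, LinearMap.sum_apply, map_smul, LinearMap.smul_apply, smul_eq_mul,
      Finset.mul_sum]
    rw [Finset.sum_comm]
    refine Finset.sum_congr rfl fun i _ => Finset.sum_congr rfl fun j _ => ?_
    rw [real_inner_comm (e j)]
    ring
  simp_rw [h1]
  rw [Finset.sum_comm]
  refine Finset.sum_congr rfl fun i _ => ?_
  rw [Finset.sum_comm]
  simp_rw [← Finset.sum_mul, e'.sum_inner_mul_inner, e.inner_eq_ite]
  simp

/-- The sum over all pairs of indices is twice the sum over the increasing pairs. -/
theorem sum_alternating_eq_two_mul [LinearOrder ι] [LocallyFiniteOrderTop ι]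
    (e : ι → V) (A B : V →ₗ[ℝ] V →ₗ[ℝ] ℝ) (hA : ∀ a, A a a = 0) (hB : ∀ a, B a a = 0) :
    ∑ i, ∑ j, A (e i) (e j) * B (e i) (e j) =
      2 * ∑ i, ∑ j ∈ Finset.Ioi i, A (e i) (e j) * B (e i) (e j) := by
  have hflip : ∀ (C : V →ₗ[ℝ] V →ₗ[ℝ] ℝ), (∀ a, C a a = 0) → ∀ a b, C a b = -C b a := by
    intro C hC a b
    have := hC (a + b)
    simp only [map_add, LinearMap.add_apply, hC] at this
    linarith
  have hs : ∀ i : ι, Finset.Ioi i = Finset.univ.filter fun j => i < j := fun i => by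
    ext j; simp
  simp_rw [hs, Finset.sum_filter]
  have h1 : ∑ i, ∑ j, A (e i) (e j) * B (e i) (e j) =
      ∑ i, ∑ j, (if i < j then A (e i) (e j) * B (e i) (e j) else 0) +
      ∑ i, ∑ j, (if j < i then A (e i) (e j) * B (e i) (e j) else 0) := by
    simp_rw [← Finset.sum_add_distrib]
    refine Finset.sum_congr rfl fun i _ => Finset.sum_congr rfl fun j _ => ?_
    rcases lt_trichotomy i j with h | h | h
    · simp [h, h.asymm]
    · subst h; simp [hA]
    · simp [h, h.asymm]
  have h2 : ∑ i, ∑ j, (if j < i then A (e i) (e j) * B (e i) (e j) else 0) =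
      ∑ i, ∑ j, (if i < j then A (e i) (e j) * B (e i) (e j) else 0) := by
    rw [Finset.sum_comm]
    refine Finset.sum_congr rfl fun i _ => Finset.sum_congr rfl fun j _ => ?_
    rw [hflip A hA (e j), hflip B hB (e j), neg_mul_neg]
  rw [h1, h2, two_mul]

/-- The scalar product of two alternating bilinear forms does not depend on the orthonormal basis
used to compute it. -/
theorem sum_alternating_orthonormalBasis_eq [LinearOrder ι] [LinearOrder κ]
    [LocallyFiniteOrderTop ι] [LocallyFiniteOrderTop κ]
    (e : OrthonormalBasis ι ℝ V) (e' : OrthonormalBasis κ ℝ V) (A B : V →ₗ[ℝ] V →ₗ[ℝ] ℝ)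
    (hA : ∀ a, A a a = 0) (hB : ∀ a, B a a = 0) :
    ∑ k, ∑ l ∈ Finset.Ioi k, A (e' k) (e' l) * B (e' k) (e' l) =
      ∑ i, ∑ j ∈ Finset.Ioi i, A (e i) (e j) * B (e i) (e j) := by
  classical
  have hfull : ∑ k, ∑ l, A (e' k) (e' l) * B (e' k) (e' l) =
      ∑ i, ∑ j, A (e i) (e j) * B (e i) (e j) := by
    have h1 : ∀ a, ∑ l, A a (e' l) * B a (e' l) = ∑ j, A a (e j) * B a (e j) := by
      intro a
      have h := sum_bilin_orthonormalBasis_eq e e'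
        (LinearMap.mk₂ ℝ (fun b c => A a b * B a c) (fun b b' c => by simp [add_mul])
          (fun r b c => by simp [mul_assoc]) (fun b c c' => by simp [mul_add])
          (fun r b c => by simp; ring))
      exact h
    simp_rw [h1]
    rw [Finset.sum_comm]
    conv_rhs => rw [Finset.sum_comm]
    refine Finset.sum_congr rfl fun j _ => ?_
    have h := sum_bilin_orthonormalBasis_eq e e'
      (LinearMap.mk₂ ℝ (fun b c => A b (e j) * B c (e j)) (fun b b' c => by simp [add_mul])
        (fun r b c => by simp [mul_assoc]) (fun b c c' => by simp [mul_add])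
        (fun r b c => by simp; ring))
    exact h
  have h1 := sum_alternating_eq_two_mul e A B hA hB
  have h2 := sum_alternating_eq_two_mul e' A B hA hB
  linarith

end OrthonormalSums

/-! ### Naturality of the exterior derivative of the dual one-form -/

section Forms

variable {n : ℕ} {M : Type*} [MetricSpace M] [ChartedSpace (Rn n) M] [IsManifold (𝓡 n) ∞ M]
  [RiemannianBundle (fun x : M => TangentSpace (𝓡 n) x)]
  [IsContMDiffRiemannianBundle (𝓡 n) ∞ (Rn n) (fun x : M => TangentSpace (𝓡 n) x)]
  [CompactSpace M] [MeasurableSpace M] [BorelSpace M]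

theorem flatInChart_apply (v : SmoothVF n M) (p : M) (y : Rn n) (w : Fin 1 → Rn n) :
    flatInChart v p y w =
      inner ℝ (v ((extChartAt (𝓡 n) p).symm y)) (chartField p (w 0) y) := rfl

theorem differentiableAt_flatInChart (v : SmoothVF n M) (p : M) {y : Rn n}
    (hy : y ∈ (extChartAt (𝓡 n) p).target) : DifferentiableAt ℝ (flatInChart v p) y := by
  have hv : ContMDiffAt 𝓘(ℝ, Rn n) ((𝓡 n).prod 𝓘(ℝ, Rn n)) ∞
      (fun y => (⟨(extChartAt (𝓡 n) p).symm y, v ((extChartAt (𝓡 n) p).symm y)⟩ :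
        TangentBundle (𝓡 n) M)) y :=
    ContMDiffAt.comp y (ContMDiffSection.contMDiff_toFun v).contMDiffAt
      ((contMDiffOn_extChartAt_symm p).contMDiffAt ((isOpen_extChartAt_target p).mem_nhds hy))
  have hc : ∀ i : Fin n, DifferentiableAt ℝ (fun y => (inner ℝ (v ((extChartAt (𝓡 n) p).symm y))
      (chartField p (EuclideanSpace.single i (1 : ℝ)) y) : ℝ)) y := by
    intro i
    have h := ContMDiffAt.inner_bundle hv ((contMDiffOn_chartField p
      (EuclideanSpace.single i 1)).contMDiffAt ((isOpen_extChartAt_target p).mem_nhds hy))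
    exact (contMDiffAt_iff_contDiffAt.1 h).differentiableAt (by simp)
  have hsum : flatInChart v p = fun y => ∑ i : Fin n,
      (inner ℝ (v ((extChartAt (𝓡 n) p).symm y))
        (chartField p (EuclideanSpace.single i (1 : ℝ)) y) : ℝ) •
      ContinuousAlternatingMap.ofSubsingleton ℝ (Rn n) ℝ (0 : Fin 1)
        (EuclideanSpace.proj i : Rn n →L[ℝ] ℝ) := by
    funext y
    ext w
    rw [flatInChart_apply, ContinuousAlternatingMap.sum_apply]
    conv_lhs => rw [← sum_smul_single (w 0), chartField_sum, inner_sum]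
    refine Finset.sum_congr rfl fun i _ => ?_
    rw [real_inner_smul_right, mul_comm]
    rfl
  rw [hsum]
  exact DifferentiableAt.fun_sum fun i _ => (hc i).smul_const _

theorem dFlat_eq (v : SmoothVF n M) (x : M) (a b : TangentSpace (𝓡 n) x) :
    dFlat v x a b = extDeriv (flatInChart v x) (extChartAt (𝓡 n) x x) ![(a : Rn n), (b : Rn n)] := by
  rw [dFlat, mfderiv_extChartAt_self]
  rfl

/-- `d(α(v))` at `x`, as a bilinear form. -/
def dFlatBilin (v : SmoothVF n M) (x : M) :
    TangentSpace (𝓡 n) x →ₗ[ℝ] TangentSpace (𝓡 n) x →ₗ[ℝ] ℝ :=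
  LinearMap.mk₂ ℝ (dFlat v x)
    (fun a a' b => by
      simp only [dFlat_eq]
      exact (extDeriv (flatInChart v x) (extChartAt (𝓡 n) x x)).toAlternatingMap.map_vecCons_add
        (m := ![(b : Rn n)]) a a')
    (fun c a b => by
      simp only [dFlat_eq]
      exact (extDeriv (flatInChart v x) (extChartAt (𝓡 n) x x)).toAlternatingMap.map_vecCons_smul
        (m := ![(b : Rn n)]) c a)
    (fun a b b' => by
      simp only [dFlat_eq]
      exact ((extDeriv (flatInChart v x)
        (extChartAt (𝓡 n) x x)).toAlternatingMap.curryLeft a).map_vecCons_add (m := ![]) b b')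
    (fun c a b => by
      simp only [dFlat_eq]
      exact ((extDeriv (flatInChart v x)
        (extChartAt (𝓡 n) x x)).toAlternatingMap.curryLeft a).map_vecCons_smul (m := ![]) c b)

theorem dFlatBilin_self (v : SmoothVF n M) (x : M) (a : TangentSpace (𝓡 n) x) :
    dFlatBilin v x a a = 0 := by
  show dFlat v x a a = 0
  rw [dFlat_eq]
  exact (extDeriv (flatInChart v x) (extChartAt (𝓡 n) x x)).map_eq_zero_of_eq _
    (i := 0) (j := 1) rfl (by simp)

variable [IsRiemannianManifold (𝓡 n) M]

/-- The one-form dual to `f_* v` pulls back to the one-form dual to `v`, since `f` preserves the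
metric. -/
theorem flatInChart_pushSmooth (f : M ≃ₘ^∞⟮𝓡 n, 𝓡 n⟯ M) (hf : Isometry f) (v : SmoothVF n M)
    (p q : M) {y : Rn n} (hy : y ∈ chartOverlap (n := n) f p q) :
    (flatInChart (pushSmooth f v) q (inCharts f p q y)).compContinuousLinearMap
      (fderiv ℝ (inCharts (n := n) f p q) y) = flatInChart v p y := by
  ext w
  show flatInChart (pushSmooth f v) q (inCharts f p q y)
    (fderiv ℝ (inCharts (n := n) f p q) y ∘ w) = _
  rw [flatInChart_apply, flatInChart_apply]
  set z := (extChartAt (𝓡 n) p).symm y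
  have hz : (extChartAt (𝓡 n) q).symm (inCharts f p q y) = f z := extChartAt_symm_inCharts f p q hy
  rw [← inner_mfderiv_of_isometry f hf z (v z)]
  have h1 := inner_vecAt_congr hz ((pushSmooth f v) ((extChartAt (𝓡 n) q).symm (inCharts f p q y)))
    (chartField q (fderiv ℝ (inCharts (n := n) f p q) y (w 0)) (inCharts f p q y))
  refine Eq.trans h1 ?_
  rw [chartField_inCharts f p q hy, SmoothVF.congr_point _ hz]
  have h2 : ((pushSmooth f v) (f z) : Rn n) = mfderiv (𝓡 n) (𝓡 n) f z (v z) :=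
    pushField_apply_image f v z
  rw [h2]
  rfl

theorem dFlat_pushSmooth (f : M ≃ₘ^∞⟮𝓡 n, 𝓡 n⟯ M) (hf : Isometry f) (v : SmoothVF n M) (x : M)
    (a b : TangentSpace (𝓡 n) x) :
    dFlat (pushSmooth f v) (f x) (mfderiv (𝓡 n) (𝓡 n) f x a) (mfderiv (𝓡 n) (𝓡 n) f x b) =
      dFlat v x a b := by
  have hx : extChartAt (𝓡 n) x x ∈ chartOverlap (n := n) f x (f x) := by
    refine ⟨mem_extChartAt_target x, ?_⟩
    rw [mem_preimage, extChartAt_to_inv]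
    exact mem_extChartAt_source (f x)
  have hfx : inCharts (n := n) f x (f x) (extChartAt (𝓡 n) x x) = extChartAt (𝓡 n) (f x) (f x) := by
    rw [inCharts, extChartAt_to_inv]
  have hev : (fun y => (flatInChart (pushSmooth f v) (f x) (inCharts f x (f x) y)
      ).compContinuousLinearMap (fderiv ℝ (inCharts (n := n) f x (f x)) y))
      =ᶠ[𝓝 (extChartAt (𝓡 n) x x)] flatInChart v x := by
    filter_upwards [(isOpen_chartOverlap f x (f x)).mem_nhds hx] with y hy
    exact flatInChart_pushSmooth f hf v x (f x) hy
  have h1 : extDeriv (fun y => (flatInChart (pushSmooth f v) (f x) (inCharts f x (f x) y)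
      ).compContinuousLinearMap (fderiv ℝ (inCharts (n := n) f x (f x)) y))
      (extChartAt (𝓡 n) x x) = _ := extDeriv_pullback (r := ∞)
    (differentiableAt_flatInChart _ _ (inCharts_mem_target f x (f x) hx))
    (contDiffAt_inCharts f x (f x) hx) (by simpa using WithTop.coe_le_coe.2 (le_top : (2 : ℕ∞) ≤ ⊤))
  rw [hev.extDeriv_eq] at h1
  have h2 : ∀ u : Rn n, fderiv ℝ (inCharts (n := n) f x (f x)) (extChartAt (𝓡 n) x x) u =
      mfderiv (𝓡 n) (𝓡 n) f x u := by
    intro u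
    have h3 := chartField_inCharts f x (f x) hx u
    have h4 : ∀ (y : M) (w : Rn n), (chartField y w (extChartAt (𝓡 n) y y) : Rn n) = w := fun y w =>
      congrArg (fun L : Rn n →L[ℝ] Rn n => L w) (mfderiv_extChartAt_symm_self y)
    rw [h4, mfderiv_apply_congr_point f (extChartAt_to_inv x), hfx, h4] at h3
    exact h3
  rw [dFlat_eq, dFlat_eq, h1]
  show _ = extDeriv (flatInChart (pushSmooth f v) (f x)) _ (_ ∘ _)
  rw [hfx]
  congr 1
  funext i
  fin_cases i
  · exact (h2 a).symm
  · exact (h2 b).symm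

/-- The derivative of an isometry at `x`, as a linear isometry between the tangent spaces. -/
def mfderivIsometry (f : M ≃ₘ^∞⟮𝓡 n, 𝓡 n⟯ M) (hf : Isometry f) (x : M) :
    TangentSpace (𝓡 n) x ≃ₗᵢ[ℝ] TangentSpace (𝓡 n) (f x) :=
  LinearIsometry.toLinearIsometryEquiv
    (LinearMap.isometryOfInner (mfderiv (𝓡 n) (𝓡 n) f x : TangentSpace (𝓡 n) x →ₗ[ℝ] _)
      (inner_mfderiv_of_isometry f hf x)) rfl

theorem innerDFlat_pushSmooth (f : M ≃ₘ^∞⟮𝓡 n, 𝓡 n⟯ M) (hf : Isometry f) (v w : SmoothVF n M)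
    (x : M) : innerDFlat (pushSmooth f v) (pushSmooth f w) (f x) = innerDFlat v w x := by
  have h := sum_alternating_orthonormalBasis_eq
    ((stdOrthonormalBasis ℝ (TangentSpace (𝓡 n) x)).map (mfderivIsometry f hf x))
    (stdOrthonormalBasis ℝ (TangentSpace (𝓡 n) (f x)))
    (dFlatBilin (pushSmooth f v) (f x)) (dFlatBilin (pushSmooth f w) (f x))
    (dFlatBilin_self _ _) (dFlatBilin_self _ _)
  refine Eq.trans h ?_
  refine Finset.sum_congr rfl fun i _ => Finset.sum_congr rfl fun j _ => ?_
  simp only [OrthonormalBasis.map_apply]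
  exact congrArg₂ (· * ·) (dFlat_pushSmooth f hf v x _ _) (dFlat_pushSmooth f hf w x _ _)

end Forms

/-! ### Invariance of the eigenspaces of the Laplacian -/

section Laplacian

variable {n : ℕ} {M : Type*} [MetricSpace M] [ChartedSpace (Rn n) M] [IsManifold (𝓡 n) ∞ M]
  [RiemannianBundle (fun x : M => TangentSpace (𝓡 n) x)]
  [IsContMDiffRiemannianBundle (𝓡 n) ∞ (Rn n) (fun x : M => TangentSpace (𝓡 n) x)]
  [CompactSpace M] [MeasurableSpace M] [BorelSpace M]

/-- The function `h ∘ f`, as a smooth function. -/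
def smoothComp (h : C^∞⟮𝓡 n, M; 𝓘(ℝ, ℝ), ℝ⟯) (f : M ≃ₘ^∞⟮𝓡 n, 𝓡 n⟯ M) :
    C^∞⟮𝓡 n, M; 𝓘(ℝ, ℝ), ℝ⟯ :=
  ⟨fun x => h (f x), h.contMDiff.comp f.contMDiff⟩

theorem differential_pushField (h : C^∞⟮𝓡 n, M; 𝓘(ℝ, ℝ), ℝ⟯) (f : M ≃ₘ^∞⟮𝓡 n, 𝓡 n⟯ M)
    (v : SmoothVF n M) (x : M) :
    differential h (f x) ((pushSmooth f v) (f x)) = differential (smoothComp h f) x (v x) := by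
  have h1 : HasMFDerivAt (𝓡 n) 𝓘(ℝ, ℝ) (smoothComp h f) x
      ((mfderiv (𝓡 n) 𝓘(ℝ, ℝ) h (f x)).comp (mfderiv (𝓡 n) (𝓡 n) f x)) :=
    (h.contMDiff.mdifferentiableAt (by simp)).hasMFDerivAt.comp x
      (f.contMDiff.mdifferentiableAt (by simp)).hasMFDerivAt
  have h2 : ((pushSmooth f v) (f x) : Rn n) = mfderiv (𝓡 n) (𝓡 n) f x (v x) :=
    pushField_apply_image f v x
  have h3 : differential (smoothComp h f) x =
      (mfderiv (𝓡 n) 𝓘(ℝ, ℝ) h (f x)).comp (mfderiv (𝓡 n) (𝓡 n) f x) := h1.mfderiv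
  rw [h3]
  exact congrArg (fun a : Rn n => differential h (f x) a) h2

theorem integral_inner_eq (v w : SmoothVF n M) :
    ∫ x, inner ℝ (v x) (w x) ∂(riemannianVolume n M) = (inner ℝ v w : ℝ) := rfl

variable (n M) in
theorem isClosed_tangentEigenspace (l : ℝ) : IsClosed (tangentEigenspace n M l : Set (L2VF n M)) := by
  have h : (tangentEigenspace n M l : Set (L2VF n M)) =
      ⋂ φ : SmoothVF n M, ⋂ ψ : SmoothVF n M, ⋂ _ : IsTangentLaplacian φ ψ,
        {u | (inner ℝ u (toL2 n M ψ) : ℝ) = l ^ 2 * inner ℝ u (toL2 n M φ)} := by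
    ext u
    simp only [mem_iInter]
    rfl
  rw [h]
  exact isClosed_iInter fun φ => isClosed_iInter fun ψ => isClosed_iInter fun _ =>
    isClosed_eq (by fun_prop) (by fun_prop)

variable [IsRiemannianManifold (𝓡 n) M]

theorem integral_differential_pushSmooth {f : M ≃ₘ^∞⟮𝓡 n, 𝓡 n⟯ M} (hf : Isometry f)
    (h : C^∞⟮𝓡 n, M; 𝓘(ℝ, ℝ), ℝ⟯) (v : SmoothVF n M) :
    ∫ x, differential h x ((pushSmooth f v) x) ∂(riemannianVolume n M) =
      ∫ x, differential (smoothComp h f) x (v x) ∂(riemannianVolume n M) := by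
  rw [← integral_comp_isometry f hf]
  exact integral_congr_ae (.of_forall fun x => differential_pushField h f v x)

theorem IsGradAdjoint.push {f : M ≃ₘ^∞⟮𝓡 n, 𝓡 n⟯ M} (hf : Isometry f) {v : SmoothVF n M}
    {h : C^∞⟮𝓡 n, M; 𝓘(ℝ, ℝ), ℝ⟯} (hv : IsGradAdjoint v h) :
    IsGradAdjoint (pushSmooth f v) (smoothComp h f.symm) := by
  intro g
  show _ = ∫ x, differential g x ((pushSmooth f v) x) ∂(riemannianVolume n M)
  rw [integral_differential_pushSmooth hf, ← integral_comp_isometry f hf]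
  refine Eq.trans ?_ (hv (smoothComp g f))
  refine integral_congr_ae (.of_forall fun x => ?_)
  show h (f.symm (f x)) * g (f x) = h x * g (f x)
  rw [f.symm_apply_apply]

/-- The Laplacian on vector fields commutes with isometries. -/
theorem IsTangentLaplacian.push {f : M ≃ₘ^∞⟮𝓡 n, 𝓡 n⟯ M} (hf : Isometry f) {v w : SmoothVF n M}
    (hvw : IsTangentLaplacian v w) : IsTangentLaplacian (pushSmooth f v) (pushSmooth f w) := by
  obtain ⟨h, hh, hw⟩ := hvw
  refine ⟨smoothComp h f.symm, hh.push hf, fun φ => ?_⟩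
  obtain ⟨ψ, rfl⟩ : ∃ ψ, φ = pushSmooth f ψ := ⟨_, (pushSmooth_pushSmooth_symm f φ).symm⟩
  have h1 : smoothComp (smoothComp h f.symm) f = h := by
    ext x
    show h (f.symm (f x)) = h x
    rw [f.symm_apply_apply]
  have h2 : ∫ x, differential (smoothComp h f.symm) x ((pushSmooth f ψ) x) ∂(riemannianVolume n M) =
      ∫ x, differential h x (ψ x) ∂(riemannianVolume n M) := by
    rw [integral_differential_pushSmooth hf, h1]
  have h3 : ∫ x, innerDFlat (pushSmooth f v) (pushSmooth f ψ) x ∂(riemannianVolume n M) =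
      ∫ x, innerDFlat v ψ x ∂(riemannianVolume n M) := by
    rw [← integral_comp_isometry f hf]
    simp_rw [innerDFlat_pushSmooth f hf]
  have h4 := hw ψ
  rw [integral_inner_eq] at h4 ⊢
  rw [inner_pushSmooth f hf, h3]
  exact h4.trans (congrArg (· + _) h2.symm)

namespace IsometricAction

variable {G : Type*} [Group G] (ρ : IsometricAction n M G)

theorem push_mem_tangentEigenspace (a : G) {l : ℝ} {u : L2VF n M}
    (hu : u ∈ tangentEigenspace n M l) : ρ.push a u ∈ tangentEigenspace n M l := by
  intro φ ψ h
  rw [inner_push_left, inner_push_left, push_toL2, push_toL2]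
  exact hu _ _ (h.push (ρ.isometry a⁻¹))

end IsometricAction

end Laplacian

/-! ### Lower bounds for `A* A` and `A A*` -/

section Hilbert

variable {H K : Type*} [NormedAddCommGroup H] [InnerProductSpace ℝ H] [CompleteSpace H]
  [NormedAddCommGroup K] [InnerProductSpace ℝ K] [CompleteSpace K]

/-- If `‖A A* u‖ ≥ c ‖u‖` for the `u ∈ A(E)`, where `E` is a closed subspace invariant under `A* A`,
then `‖A* A w‖ ≥ c ‖w‖` for the `w ∈ E` in the range of `A* A`. -/
theorem norm_adjoint_comp_ge (A : H →L[ℝ] K) {E : Submodule ℝ H} (hE : IsClosed (E : Set H))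
    (hinv : ∀ y ∈ E, ContinuousLinearMap.adjoint A (A y) ∈ E) {c : ℝ} (hc : 0 ≤ c)
    (hA : ∀ y ∈ E, c * ‖A y‖ ≤ ‖A (ContinuousLinearMap.adjoint A (A y))‖) {w : H} (hw : w ∈ E)
    (hr : ∃ y, ContinuousLinearMap.adjoint A (A y) = w) :
    c * ‖w‖ ≤ ‖ContinuousLinearMap.adjoint A (A w)‖ := by
  have hsym : ∀ x y, (inner ℝ (ContinuousLinearMap.adjoint A (A x)) y : ℝ) = inner ℝ (A x) (A y) :=
    fun x y => ContinuousLinearMap.adjoint_inner_left A y (A x)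
  -- the preimage of `w` may be taken in `E`: replace it by its orthogonal projection
  obtain ⟨y, hy, rfl⟩ : ∃ y ∈ E, ContinuousLinearMap.adjoint A (A y) = w := by
    have : CompleteSpace E := hE.completeSpace_coe
    obtain ⟨z, hz⟩ := hr
    refine ⟨E.starProjection z, E.starProjection_apply_mem z, ?_⟩
    have h1 : w - ContinuousLinearMap.adjoint A (A (E.starProjection z)) =
        ContinuousLinearMap.adjoint A (A (z - E.starProjection z)) := by
      rw [map_sub, map_sub, hz]
    have h2 : w - ContinuousLinearMap.adjoint A (A (E.starProjection z)) ∈ E :=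
      E.sub_mem hw (hinv _ (E.starProjection_apply_mem z))
    have h3 : w - ContinuousLinearMap.adjoint A (A (E.starProjection z)) ∈ Eᗮ := by
      rw [h1, Submodule.mem_orthogonal']
      intro e he
      rw [hsym, real_inner_comm, ← hsym]
      exact E.sub_starProjection_mem_orthogonal z _ (hinv e he)
    have h4 : w - ContinuousLinearMap.adjoint A (A (E.starProjection z)) = 0 :=
      Submodule.disjoint_def.1 E.orthogonal_disjoint _ h2 h3
    exact (sub_eq_zero.1 h4).symm
  set w := ContinuousLinearMap.adjoint A (A y) with hwdef
  have h1 : ‖w‖ ^ 2 ≤ ‖A y‖ * ‖A w‖ := by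
    rw [← real_inner_self_eq_norm_sq]
    nth_rewrite 1 [hwdef]
    rw [hsym]
    exact real_inner_le_norm _ _
  have h2 : ‖A w‖ ^ 2 ≤ ‖ContinuousLinearMap.adjoint A (A w)‖ * ‖w‖ := by
    rw [← real_inner_self_eq_norm_sq, ← hsym]
    exact real_inner_le_norm _ _
  have h3 : c * ‖A y‖ ≤ ‖A w‖ := hA y hy
  rcases (norm_nonneg w).eq_or_lt with h0 | h0
  · rw [← h0, mul_zero]
    exact norm_nonneg _
  refine le_of_mul_le_mul_right ?_ h0
  calc c * ‖w‖ * ‖w‖ = c * ‖w‖ ^ 2 := by ring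
    _ ≤ c * (‖A y‖ * ‖A w‖) := by gcongr
    _ = c * ‖A y‖ * ‖A w‖ := by ring
    _ ≤ ‖A w‖ * ‖A w‖ := by gcongr
    _ = ‖A w‖ ^ 2 := by ring
    _ ≤ _ := h2

end Hilbert

/-! ### The Box operator -/

section Box

/-- A sum over increasing pairs of the two orderings of a pair is a sum over all pairs, if the
diagonal terms vanish. -/
theorem sum_pairs_eq {k : ℕ} (F : Fin k → Fin k → ℝ) (h0 : ∀ a, F a a = 0) :
    ∑ q : {q : Fin k × Fin k // q.1 < q.2}, (F q.1.1 q.1.2 + F q.1.2 q.1.1) =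
      ∑ a, ∑ b, F a b := by
  have h1 : ∑ q : {q : Fin k × Fin k // q.1 < q.2}, (F q.1.1 q.1.2 + F q.1.2 q.1.1) =
      ∑ a, ∑ b, (if a < b then F a b + F b a else 0) := by
    rw [← Fintype.sum_prod_type' (f := fun a b => if a < b then F a b + F b a else 0),
      ← Finset.sum_filter]
    exact (Finset.sum_subtype _ (by simp) (fun q : Fin k × Fin k => F q.1 q.2 + F q.2 q.1)).symm
  have h2 : ∑ a, ∑ b, (if a < b then F b a else 0) = ∑ a, ∑ b, (if b < a then F a b else 0) :=
    Finset.sum_comm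
  have h3 : ∀ a b, (if a < b then F a b + F b a else 0) =
      (if a < b then F a b else 0) + (if a < b then F b a else 0) := fun a b => by
    split_ifs <;> simp
  simp_rw [h1, h3, Finset.sum_add_distrib]
  rw [h2]
  simp_rw [← Finset.sum_add_distrib]
  refine Finset.sum_congr rfl fun a _ => Finset.sum_congr rfl fun b _ => ?_
  rcases lt_trichotomy a b with h | h | h
  · simp [h, h.asymm]
  · subst h; simp [h0]
  · simp [h, h.asymm]

variable {n : ℕ} {M : Type*} [MetricSpace M] [ChartedSpace (Rn n) M] [IsManifold (𝓡 n) ∞ M]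
  [RiemannianBundle (fun x : M => TangentSpace (𝓡 n) x)]
  [IsContMDiffRiemannianBundle (𝓡 n) ∞ (Rn n) (fun x : M => TangentSpace (𝓡 n) x)]
  [CompactSpace M] [MeasurableSpace M] [BorelSpace M] [IsRiemannianManifold (𝓡 n) M]

namespace IsometricAction

variable {G : Type*} [Group G] (ρ : IsometricAction n M G) {k : ℕ} (γ : Fin k → G)

/-- The operator `1 - ρ(a)_*` on `L²(M, TM)`. -/
def diff (a : G) : L2VF n M →L[ℝ] L2VF n M := ContinuousLinearMap.id ℝ (L2VF n M) - ρ.push a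

theorem diff_apply (a : G) (u : L2VF n M) : ρ.diff a u = u - ρ.push a u := rfl

theorem inner_diff_left (a : G) (u v : L2VF n M) :
    (inner ℝ (ρ.diff a u) v : ℝ) = inner ℝ u (ρ.diff a⁻¹ v) := by
  rw [diff_apply, diff_apply, inner_sub_left, inner_sub_right, inner_push_left]

theorem d₀Adj_apply (u : L2Tuple n M (Fin k)) :
    ρ.d₀Adj γ u = ∑ l, ρ.diff (γ l)⁻¹ (u l) := by
  refine ext_inner_left ℝ fun w => ?_
  rw [d₀Adj, ContinuousLinearMap.adjoint_inner_right, PiLp.inner_apply, inner_sum]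
  exact Finset.sum_congr rfl fun l _ => ρ.inner_diff_left _ _ _

theorem d₀Adj_d₀_mem_tangentEigenspace {l : ℝ} {u : L2VF n M}
    (hu : u ∈ tangentEigenspace n M l) : ρ.d₀Adj γ (ρ.d₀ γ u) ∈ tangentEigenspace n M l := by
  have hd : ∀ (a : G) {u : L2VF n M}, u ∈ tangentEigenspace n M l →
      ρ.diff a u ∈ tangentEigenspace n M l := fun a u hu =>
    (tangentEigenspace n M l).sub_mem hu (ρ.push_mem_tangentEigenspace a hu)
  rw [d₀Adj_apply]
  exact Submodule.sum_mem _ fun i _ => hd _ (hd _ hu)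

end IsometricAction

namespace IsometricAction

variable {G : Type*} [CommGroup G] (ρ : IsometricAction n M G) {k : ℕ} (γ : Fin k → G)

theorem diff_comm (a b : G) (u : L2VF n M) : ρ.diff a (ρ.diff b u) = ρ.diff b (ρ.diff a u) := by
  simp only [diff_apply, map_sub, ← push_mul_apply, mul_comm a b]
  abel

/-- The component of `d₁` at the relation `γ_a γ_b γ_a⁻¹ γ_b⁻¹`: since the group is abelian, the
four terms are `u_a`, `ρ(γ_a)_* u_b`, `-ρ(γ_b)_* u_a` and `-u_b`. -/
theorem d₁_commutatorWords (u : L2Tuple n M (Fin k)) (q : {q : Fin k × Fin k // q.1 < q.2}) :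
    ρ.d₁ γ (commutatorWords k) u q =
      ρ.diff (γ q.1.2) (u q.1.1) - ρ.diff (γ q.1.1) (u q.1.2) := by
  obtain ⟨⟨a, b⟩, hab⟩ := q
  have h1 : ρ.d₁ γ (commutatorWords k) u ⟨(a, b), hab⟩ = ∑ z : Fin 4,
      (ρ.push ((([(a, true), (b, true), (a, false), (b, false)] : List (Fin k × Bool)).take z).map
        (letter γ)).prod) (ρ.component γ
          (([(a, true), (b, true), (a, false), (b, false)] : List (Fin k × Bool)).get z) u) := by
    show (∑ z : Fin 4, (ρ.push ((([(a, true), (b, true), (a, false), (b, false)] :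
      List (Fin k × Bool)).take z).map (letter γ)).prod).comp (ρ.component γ
          (([(a, true), (b, true), (a, false), (b, false)] : List (Fin k × Bool)).get z))) u = _
    rw [_root_.sum_apply]
    rfl
  have ht : ∀ c, ρ.component γ (c, true) u = u c := fun c => rfl
  have hf : ∀ c, ρ.component γ (c, false) u = -ρ.push (γ c)⁻¹ (u c) := fun c => rfl
  rw [h1, Fin.sum_univ_four]
  simp [ht, hf, letter, push_one_apply, ← push_mul_apply, diff_apply]
  abel

/-- The Box operator acts diagonally, by `d₀* d₀` on each component. -/
theorem box_apply (u : L2Tuple n M (Fin k)) (i : Fin k) :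
    ρ.box γ (commutatorWords k) u i = ρ.d₀Adj γ (ρ.d₀ γ (u i)) := by
  let w : L2Tuple n M (Fin k) := WithLp.toLp 2 fun i => ρ.d₀Adj γ (ρ.d₀ γ (u i))
  suffices h : ρ.box γ (commutatorWords k) u = w from congrArg (fun w : L2Tuple n M (Fin k) => w i) h
  refine ext_inner_right ℝ fun v => ?_
  let X : Fin k → Fin k → L2VF n M := fun a b => ρ.diff (γ b) (u a) - ρ.diff (γ a) (u b)
  -- `X` is antisymmetric, so that `F a b + F b a` is the scalar product of the components of `d₁ u`
  -- and `d₁ v` at the pair `(a, b)`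
  let F : Fin k → Fin k → ℝ := fun a b => inner ℝ (X a b) (ρ.diff (γ b) (v a))
  have hX : ∀ a b, X b a = -X a b := fun a b => by simp only [X]; abel
  have h1 : (inner ℝ (ρ.d₁ γ (commutatorWords k) u) (ρ.d₁ γ (commutatorWords k) v) : ℝ) =
      ∑ a, ∑ b, F a b := by
    rw [← sum_pairs_eq F fun a => by simp [F, X], PiLp.inner_apply]
    refine Finset.sum_congr rfl fun q _ => ?_
    rw [d₁_commutatorWords, d₁_commutatorWords, inner_sub_right]
    simp only [F]
    rw [hX q.1.1 q.1.2, inner_neg_left, sub_eq_add_neg]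
  have h2 : ∀ a b, F a b = inner ℝ (ρ.diff (γ b)⁻¹ (ρ.diff (γ b) (u a))) (v a) -
      inner ℝ (ρ.diff (γ b)⁻¹ (u b)) (ρ.diff (γ a)⁻¹ (v a)) := by
    intro a b
    have h3 : ∀ x y : L2VF n M, (inner ℝ x (ρ.diff (γ b) y) : ℝ) =
        inner ℝ (ρ.diff (γ b)⁻¹ x) y := fun x y => by rw [inner_diff_left, inv_inv]
    rw [← inner_diff_left, ← inner_sub_left, ρ.diff_comm (γ a), ← map_sub, ← h3]
  have h4 : (inner ℝ (ρ.d₀Adj γ u) (ρ.d₀Adj γ v) : ℝ) = ∑ a, ∑ b,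
      inner ℝ (ρ.diff (γ b)⁻¹ (u b)) (ρ.diff (γ a)⁻¹ (v a)) := by
    rw [d₀Adj_apply, d₀Adj_apply, inner_sum]
    exact Finset.sum_congr rfl fun a _ => sum_inner _ _ _
  have h5 : (inner ℝ w v : ℝ) = ∑ a, ∑ b,
      inner ℝ (ρ.diff (γ b)⁻¹ (ρ.diff (γ b) (u a))) (v a) := by
    rw [PiLp.inner_apply]
    refine Finset.sum_congr rfl fun a _ => ?_
    show (inner ℝ (ρ.d₀Adj γ (ρ.d₀ γ (u a))) (v a) : ℝ) = _
    rw [d₀Adj_apply, sum_inner]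
    rfl
  have h6 : (inner ℝ (ρ.box γ (commutatorWords k) u) v : ℝ) =
      inner ℝ (ρ.d₀Adj γ u) (ρ.d₀Adj γ v) +
      inner ℝ (ρ.d₁ γ (commutatorWords k) u) (ρ.d₁ γ (commutatorWords k) v) := by
    rw [box, _root_.add_apply, inner_add_left]
    congr 1
    · exact (ContinuousLinearMap.adjoint_inner_right (ρ.d₀ γ) _ _).symm
    · exact ContinuousLinearMap.adjoint_inner_left (ρ.d₁ γ (commutatorWords k)) _ _
  rw [h6, h4, h1, h5, ← Finset.sum_add_distrib]
  refine Finset.sum_congr rfl fun a _ => ?_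
  rw [← Finset.sum_add_distrib]
  refine Finset.sum_congr rfl fun b _ => ?_
  rw [h2]
  ring

theorem isBoxDiophantine_of_isD₀Diophantine (h : ρ.IsD₀Diophantine γ) :
    ρ.IsBoxDiophantine γ (commutatorWords k) := by
  obtain ⟨σ, τ, hσ, hτ, H⟩ := h
  refine ⟨σ, τ, hσ, hτ, fun l hl u hu huE => ?_⟩
  set c := σ / (1 + l) ^ τ with hc
  have hl0 : 0 ≤ l := hl.1
  have hc0 : 0 ≤ c := by positivity
  obtain ⟨v, rfl⟩ := hu
  set u := ρ.box γ (commutatorWords k) v with hu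
  have key : ∀ i, c * ‖u i‖ ≤ ‖ρ.box γ (commutatorWords k) u i‖ := by
    intro i
    rw [ρ.box_apply γ u i]
    refine norm_adjoint_comp_ge (ρ.d₀ γ) (isClosed_tangentEigenspace n M l)
      (fun y hy => ρ.d₀Adj_d₀_mem_tangentEigenspace γ hy) hc0 (fun y hy => ?_) (huE i)
      ⟨v i, (ρ.box_apply γ v i).symm⟩
    refine H l hl _ ⟨y, rfl⟩ fun j => ?_
    exact (tangentEigenspace n M l).sub_mem hy (ρ.push_mem_tangentEigenspace _ hy)
  refine le_of_sq_le_sq ?_ (norm_nonneg _)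
  rw [mul_pow, PiLp.norm_sq_eq_of_L2, PiLp.norm_sq_eq_of_L2, Finset.mul_sum]
  refine Finset.sum_le_sum fun i _ => ?_
  rw [← mul_pow]
  exact pow_le_pow_left₀ (by positivity) (key i) 2

end IsometricAction

end Box

end

theorem proposition4p1 (n : ℕ) (M : Type*) [MetricSpace M] [CompactSpace M] [ConnectedSpace M]
    [ChartedSpace (Rn n) M] [IsManifold (𝓡 n) ∞ M]
    [RiemannianBundle (fun x : M => TangentSpace (𝓡 n) x)]
    [IsContMDiffRiemannianBundle (𝓡 n) ∞ (Rn n) (fun x : M => TangentSpace (𝓡 n) x)]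
    [IsRiemannianManifold (𝓡 n) M] [MeasurableSpace M] [BorelSpace M]
    (G : Type*) [CommGroup G] (k : ℕ) (γ : Fin k → G)
    (hγ : Subgroup.closure (Set.range γ) = ⊤) (ρ : IsometricAction n M G) :
    (∀ (u : L2Tuple n M (Fin k)) (i : Fin k),
      ρ.box γ (commutatorWords k) u i = ρ.d₀Adj γ (ρ.d₀ γ (u i))) ∧
    (ρ.IsD₀Diophantine γ → ρ.IsBoxDiophantine γ (commutatorWords k)) :=
  ⟨ρ.box_apply γ, ρ.isBoxDiophantine_of_isD₀Diophantine γ⟩
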